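/- Let $[n]=\{1,\dots,n\}$ ($n\ge 0$). For a reflexive binary relation $R$ on $[n]$ put $\mathrm{Inc}(R)=\{(a,b)\in R: a\le b\}$ and $\mathrm{Dec}(R)=\{(b,a)\in R: a\le b\}$, and order such relations by the weak order: $R\le S$ if and only if $\mathrm{Inc}(R)\supseteq\mathrm{Inc}(S)$ and $\mathrm{Dec}(R)\subseteq \mathrm{Dec}(S)$. Let $\mathrm{IPos}(n)$ be the set of reflexive, transitive and antisymmetric relations on $[n]$. Under the weak order it is a lattice with meet and join $$R\wedge_T S=\big((\mathrm{Inc}R\cup\mathrm{Inc}S)^{tc}\cup(\mathrm{Dec}R\cap\mathrm{Dec}S)\big)^{tdd},\qquad R\vee_T S=\big((\mathrm{Inc}R\cap\mathrm{Inc}S)\cup(\mathrm{Dec}R\cup\mathrm{Dec}S)^{tc}\big)^{tid},$$ where $^{tc}$ is the transitive closure, $M^{tdd}$ is obtained from $M$ by deleting all $(b,a)\in \mathrm{Dec}(M)$ for which there are $i\le b$ and $j\ge a$ with $(i,b),(b,a),(a,j)\in M$ and $(i,j)\notin M$, and $M^{tid}$ is obtained from $M$ by deleting all $(a,b)\in\mathrm{Inc}(M)$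 for which there are $i\ge a$ and $j\le b$ with $(i,a),(a,b),(b,j)\in M$ and $(i,j)\notin M$. An orientation $\delta=(n,\delta^+,\delta^-)$ consists of two subsets $\delta^+,\delta^-\subseteq[n]$; it is covering if $\{2,\dots,n-1\}\subseteq\delta^+\cup\delta^-$. A permutree with orientation $\delta$ is a directed tree $T$ with vertex set $[n]$ such that every vertex $v\notin\delta^+$ has one, possibly empty, parent (outgoing neighbour); every vertex $v\in\delta^+$ has a left and a right parent, each possibly empty, all labels in the subtree through the left (resp. right) parent being smaller (resp. larger) than $v$; and likewise for children (incoming neighbours) with $\delta^-$ in place of $\delta^+$. Write $i\preccurlyeq_T j$ if $T$ has a directed path from $i$ to $j$, and let $\mathrm{PEP}(\delta)=\{\preccurlyeq_T\,: T \text{ a permutree with orientation }\delta\}$. **Theorem.** For every covering orientation $\delta$ of $[n]$, $\mathrm{PEP}(\delta)$ induces a sublattice of $(\mathrm{IPos}(n),\le,\wedge_T,\vee_T)$: it is a subset of $\mathrm{IPos}(n)$ closed under $\wedge_T$ and $\vee_T$. **Corollary.** The Tamari lattice, every type $A$ Cambrian lattice, and the boolean lattice are sublattices of $(\mathrm{IPos}(n),\le,\wedge_T,\vee_T)$.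 More precisely, each of the following is a lattice, and it has an order embedding into $\mathrm{IPos}(n)$ that sends its meet to $\wedge_T$ and its join to $\vee_T$ and has the indicated image: 1. the Tamari lattice on planar binary trees with $n$ nodes (the reflexive transitive closure of right rotation), with image $\mathrm{PEP}(n,\varnothing,[n])$; 2. for every partition $\delta^+\sqcup\delta^-=[n]$, the Cambrian lattice of $\delta$ on the symmetric group $\mathfrak S_n$ (type $A_{n-1}$), i.e. the quotient of the weak order on $\mathfrak S_n$ (inclusion of inversion sets) by the equivalence relation generated by $UacVbW\equiv UcaVbW$ for $a<b<c$, $b\in\delta^-$, and $UbVacW\equiv UbVcaW$ for $a<b<c$, $b\in\delta^+$, ordered by $x\le y$ if and only if some representative of $x$ is below some representative of $y$; with image $\mathrm{PEP}(\delta)$; 3. the boolean lattice of subsets of an $(n-1)$-element set (a one-element lattice if $n=0$), with image $\mathrm{PEP}(n,[n],[n])$. -/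

import Mathlib

namespace IntegerPosets

/-! ### The weak order on integer relations

The ground set `[n] = {1, …, n}` is modelled by `Fin n` with its natural order
(`i : Fin n` stands for the integer `i + 1`). -/

/-- Binary relations on `[n]`. -/
def IRel (n : ℕ) : Type := Fin n → Fin n → Prop

variable {n : ℕ}

/-- The increasing subrelation of `R`. -/
def inc (R : IRel n) : IRel n := fun a b => a ≤ b ∧ R a b

/-- The decreasing subrelation of `R`. -/
def dec (R : IRel n) : IRel n := fun b a => a ≤ b ∧ R b a

/-- The weak order: `R ≤ S` iff `Inc R ⊇ Inc S` and `Dec R ⊆ Dec S`. -/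
instance : PartialOrder (IRel n) where
  le R S := (∀ a b, inc S a b → inc R a b) ∧ (∀ a b, dec R a b → dec S a b)
  le_refl R := ⟨fun _ _ h => h, fun _ _ h => h⟩
  le_trans R S T h k :=
    ⟨fun a b x => h.1 a b (k.1 a b x), fun a b x => k.2 a b (h.2 a b x)⟩
  le_antisymm R S h k := by
    funext a b
    apply propext
    rcases le_total a b with hab | hab
    · exact ⟨fun x => (k.1 a b ⟨hab, x⟩).2, fun x => (h.1 a b ⟨hab, x⟩).2⟩
    · exact ⟨fun x => (h.2 a b ⟨hab, x⟩).2, fun x => (k.2 a b ⟨hab, x⟩).2⟩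

/-- Integer posets: reflexive, transitive and antisymmetric relations on `[n]`. -/
def IPos (n : ℕ) : Set (IRel n) :=
  {R | (∀ u, R u u) ∧ (∀ u v w, R u v → R v w → R u w) ∧ (∀ u v, R u v → R v u → u = v)}

/-- The transitive decreasing deletion. -/
def tdd (R : IRel n) : IRel n := fun b a =>
  R b a ∧ ¬ (a ≤ b ∧ ∃ i j, i ≤ b ∧ a ≤ j ∧ R i b ∧ R b a ∧ R a j ∧ ¬ R i j)

/-- The transitive increasing deletion. -/
def tid (R : IRel n) : IRel n := fun a b =>
  R a b ∧ ¬ (a ≤ b ∧ ∃ i j, a ≤ i ∧ j ≤ b ∧ R i a ∧ R a b ∧ R b j ∧ ¬ R i j)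

/-- The transitive meet `((Inc R ∪ Inc S)^tc ∪ (Dec R ∩ Dec S))^tdd`. -/
def meetT (R S : IRel n) : IRel n :=
  tdd fun u v =>
    Relation.TransGen (fun a b => inc R a b ∨ inc S a b) u v ∨ (dec R u v ∧ dec S u v)

/-- The transitive join `((Inc R ∩ Inc S) ∪ (Dec R ∪ Dec S)^tc)^tid`. -/
def joinT (R S : IRel n) : IRel n :=
  tid fun u v =>
    (inc R u v ∧ inc S u v) ∨ Relation.TransGen (fun a b => dec R a b ∨ dec S a b) u v

/-- Under the weak order, `A` is a lattice with meet `meetT` and join `joinT`. -/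
def IsLatticeUnderMeetTJoinT (A : Set (IRel n)) : Prop :=
  ∀ R ∈ A, ∀ S ∈ A,
    (meetT R S ∈ A ∧ ∀ T ∈ A, T ≤ meetT R S ↔ T ≤ R ∧ T ≤ S) ∧
    (joinT R S ∈ A ∧ ∀ T ∈ A, joinT R S ≤ T ↔ R ≤ T ∧ S ≤ T)

/-- `A` induces a sublattice of `(IPos(n), ≤, meetT, joinT)`. -/
def InducesSublattice (A : Set (IRel n)) : Prop :=
  A ⊆ IPos n ∧ ∀ R ∈ A, ∀ S ∈ A, meetT R S ∈ A ∧ joinT R S ∈ A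

/-- The set `P` ordered by `le` is a lattice, and `f` is an embedding of it into
`(IPos(n), ≤, meetT, joinT)` as an ordered set which turns meets into `meetT` and joins
into `joinT`. -/
structure IsLatticeEmbedding {P : Type} (le : P → P → Prop) (f : P → IRel n) : Prop where
  mem (x : P) : f x ∈ IPos n
  injective : Function.Injective f
  le_iff (x y : P) : le x y ↔ f x ≤ f y
  exists_meet (x y : P) :
    ∃ m, (le m x ∧ le m y ∧ ∀ z, le z x → le z y → le z m) ∧ f m = meetT (f x) (f y)
  exists_join (x y : P) :
    ∃ j, (le x j ∧ le y j ∧ ∀ z, le x z → le y z → le j z) ∧ f j = joinT (f x) (f y)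

/-! ### Permutrees and their posets -/

/-- An orientation `(n, δ⁺, δ⁻)` of `[n]`: two arbitrary subsets of `[n]`. -/
structure PermutreeOrientation (n : ℕ) where
  pos : Set (Fin n)
  neg : Set (Fin n)

/-- `{2, …, n - 1} ⊆ δ⁺ ∪ δ⁻`. -/
def PermutreeOrientation.IsCovering (δ : PermutreeOrientation n) : Prop :=
  ∀ i : Fin n, 0 < i.val → i.val + 1 < n → i ∈ δ.pos ∪ δ.neg

/-- The vertex set of the subtree of the tree `G` seen from its vertex `v` through the
neighbour `u`: the component of `u` after removal of the edge `uv`. -/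
def subtree (G : SimpleGraph (Fin n)) (v u : Fin n) : Set (Fin n) :=
  {w | (G.deleteEdges {s(v, u)}).Reachable u w}

/-- The condition at a vertex `v` of the tree `G` on the set `N` of its (nonempty) parents,
or of its (nonempty) children. If `v` has a single slot on this side (`¬ two`), there is at most
one of them. If `v` has two slots (`two`), a left and a right one, each possibly empty, then there
is at most one on the left (label smaller than `v`) and at most one on the right (label larger
than `v`); the labels in the left subtree are smaller than `v` and those in the right subtree
are larger than `v`. -/
def SlotCondition (G : SimpleGraph (Fin n)) (v : Fin n) (two : Prop) (N : Set (Fin n)) : Prop :=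
  (¬ two → ∀ p ∈ N, ∀ q ∈ N, p = q) ∧
  (two →
    (∀ p ∈ N, ∀ q ∈ N, (p < v ↔ q < v) → p = q) ∧
    (∀ p ∈ N, p < v → ∀ w ∈ subtree G v p, w < v) ∧
    (∀ p ∈ N, v < p → ∀ w ∈ subtree G v p, v < w))

/-- Permutrees with orientation `δ`. Vertices are identified with their labels; `up i j` means
that there is an edge from `i` to `j`, that is, `j` is a parent of `i` and `i` is a child of `j`.
The relation `up` orients each edge of the underlying tree exactly once. (A tree is a connected
acyclic graph; for `n = 0` the empty tree is allowed.) The vertices with two parents are those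
in `δ⁺` and the vertices with two children those in `δ⁻`. -/
structure IsPermutree (δ : PermutreeOrientation n) (up : Fin n → Fin n → Prop) : Prop where
  asymm : ∀ i j, up i j → ¬ up j i
  connected : (SimpleGraph.fromRel up).Preconnected
  acyclic : (SimpleGraph.fromRel up).IsAcyclic
  parents : ∀ v, SlotCondition (SimpleGraph.fromRel up) v (v ∈ δ.pos) {p | up v p}
  children : ∀ v, SlotCondition (SimpleGraph.fromRel up) v (v ∈ δ.neg) {c | up c v}

/-- The relation `≼_T` of a permutree: `i ≼_T j` iff there is an oriented path from `i` to `j`. -/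
def permutreeRel (up : Fin n → Fin n → Prop) : IRel n := Relation.ReflTransGen up

/-- Permutree element posets for the orientation `δ`. -/
def PEP (δ : PermutreeOrientation n) : Set (IRel n) :=
  {R | ∃ up, IsPermutree δ up ∧ R = permutreeRel up}

/-! ### The Tamari lattice -/

/-- One right rotation somewhere in a planar binary tree. -/
inductive RightRotation : BinaryTree Unit → BinaryTree Unit → Prop
  | root (A B C : BinaryTree Unit) :
      RightRotation (.node () (.node () A B) C) (.node () A (.node () B C))
  | left (l l' r : BinaryTree Unit) :
      RightRotation l l' → RightRotation (.node () l r) (.node () l' r)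
  | right (l r r' : BinaryTree Unit) :
      RightRotation r r' → RightRotation (.node () l r) (.node () l r')

/-- The planar binary trees with `n` nodes. -/
def TamariTree (n : ℕ) : Type := {t : BinaryTree Unit // t.numNodes = n}

/-- The Tamari order: the reflexive transitive closure of right rotation. -/
def tamariLE (s t : TamariTree n) : Prop := Relation.ReflTransGen RightRotation s.1 t.1

/-! ### The Cambrian lattices of type A -/

/-- The weak order on permutations, by inclusion of inversions: a permutation `σ` is seen as
the word `σ(1) … σ(n)`, and the pair `a < b` is an inversion of `σ` if `b` stands before `a`. -/
def permWeakLE (σ τ : Equiv.Perm (Fin n)) : Prop :=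
  ∀ a b, a < b → σ.symm b < σ.symm a → τ.symm b < τ.symm a

/-- The elementary moves of the Cambrian congruence, for `a < b < c`:
`U a c V b W ≡ U c a V b W` if `b ∈ δ⁻`, and `U b V a c W ≡ U b V c a W` if `b ∈ δ⁺`. -/
def CambrianMove (δ : PermutreeOrientation n) (σ τ : Equiv.Perm (Fin n)) : Prop :=
  ∃ k l : Fin n, l.val = k.val + 1 ∧ τ = σ * Equiv.swap k l ∧
    ∃ b, σ k < b ∧ b < σ l ∧
      ((b ∈ δ.neg ∧ l < σ.symm b) ∨ (b ∈ δ.pos ∧ σ.symm b < k))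

/-- The classes of the Cambrian congruence, i.e. of the equivalence relation on permutations
generated by the elementary moves. -/
def CambrianClass (δ : PermutreeOrientation n) : Type := Quot (CambrianMove δ)

/-- The Cambrian order: the quotient of the weak order by the Cambrian congruence. -/
def cambrianLE (δ : PermutreeOrientation n) (x y : CambrianClass δ) : Prop :=
  ∃ σ τ : Equiv.Perm (Fin n),
    Quot.mk (CambrianMove δ) σ = x ∧ Quot.mk (CambrianMove δ) τ = y ∧ permWeakLE σ τ

end IntegerPosets

open IntegerPosets

namespace IntegerPosets

variable {n : ℕ}

/-! Reversing all pairs exchanges `inc` with `dec` and turns joins into meets (`joinT_eq_op_meetT`),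
so only meets need an argument.

For integer posets, a common lower bound `T` of `R` and `S` contains the closure of both increasing
parts, and its decreasing pairs lie in both relations. Transitivity of `T` makes each of them
compatible with all increasing chains at its two ends, which is exactly the test that `tdd` imposes
(`le_meetT_iff`).

For a covering orientation, `PEP δ` consists of the posets satisfying three conditions (`IsPEP`,
`mem_PEP_iff`). If `a → c` passes over `b` between them, then `b ∈ δ⁻` forces `b → c` and `b ∈ δ⁺`
forces `a → b`. Moreover two labels `a`, `c` can be incomparable only if some label between them
separates them as seen from `a`. Walking along the tree proves this for permutrees. Conversely, the
Hasse diagram of such a poset is a permutree: each vertex `v` splits the others into `upSide` and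
`downSide`, and no cover relation joins the two sides, so every edge is a bridge.

Under these conditions the relation `preMeet` is already transitive (`preMeet_trans`), hence `tdd`
deletes nothing. The first two conditions pass to `preMeet` directly, the third by an induction on
the distance of the labels (`preMeet_link`). This gives the sublattice property.

For the corollary, an order embedding with image `PEP δ` automatically transports meets and joins
(`isLatticeEmbedding_of_range`), so only order embeddings with the right image are needed. In the
Cambrian case each permutation is a linear extension of exactly one poset of `PEP δ`, namely `linRel
δ σ`. The fibres are the congruence classes, and each contains a permutation whose inversions are
the decreasing pairs of the poset. Binary trees are encoded by their descendant relation in inorder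
labelling, subsets by the directions of the relations between consecutive labels. -/

/-! ### Opposite relations -/

/-- The opposite of a relation. -/
def IRel.op (R : IRel n) : IRel n := fun a b => R b a

theorem IRel.op_op (R : IRel n) : R.op.op = R := rfl

theorem IRel.op_le_op {R S : IRel n} : R.op ≤ S.op ↔ S ≤ R :=
  ⟨fun h => ⟨fun a b => h.2 b a, fun a b => h.1 b a⟩,
    fun h => ⟨fun a b => h.2 b a, fun a b => h.1 b a⟩⟩

theorem op_mem_IPos {R : IRel n} (h : R ∈ IPos n) : R.op ∈ IPos n :=
  ⟨h.1, fun u v w huv hvw => h.2.1 w v u hvw huv, fun u v huv hvu => h.2.2 u v hvu huv⟩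

theorem tid_eq_op_tdd (M : IRel n) : tid M = (tdd M.op).op := by
  funext a b
  apply propext
  constructor
  · rintro ⟨h, k⟩
    exact ⟨h, fun ⟨hab, i, j, hi, hj, h1, h2, h3, h4⟩ => k ⟨hab, j, i, hj, hi, h3, h2, h1, h4⟩⟩
  · rintro ⟨h, k⟩
    exact ⟨h, fun ⟨hab, i, j, hi, hj, h1, h2, h3, h4⟩ => k ⟨hab, j, i, hj, hi, h3, h2, h1, h4⟩⟩

/-- Every statement about joins below is the corresponding one about meets, applied to opposite
relations. -/
theorem joinT_eq_op_meetT (R S : IRel n) : joinT R S = (meetT R.op S.op).op := by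
  have key : (fun u v => (inc R u v ∧ inc S u v) ∨
      Relation.TransGen (fun a b => dec R a b ∨ dec S a b) u v : IRel n) =
      (fun u v => Relation.TransGen (fun a b => inc R.op a b ∨ inc S.op a b) v u ∨
        (dec R.op v u ∧ dec S.op v u) : IRel n) := by
    funext u v
    apply propext
    rw [or_comm, ← Relation.transGen_swap]
    rfl
  exact (congrArg tid key).trans (tid_eq_op_tdd _)

/-! ### The relation from which the transitive meet is obtained by deletion -/

/-- The transitive closure of the union of the increasing parts. -/
def incClosure (R S : IRel n) : IRel n :=
  Relation.TransGen fun a b => inc R a b ∨ inc S a b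

/-- The union of `incClosure R S` and of the common decreasing part. -/
def preMeet (R S : IRel n) : IRel n := fun u v =>
  incClosure R S u v ∨ (dec R u v ∧ dec S u v)

theorem meetT_eq (R S : IRel n) : meetT R S = tdd (preMeet R S) := rfl

theorem preMeet_comm (R S : IRel n) : preMeet R S = preMeet S R := by
  unfold preMeet incClosure
  funext u v
  simp only [or_comm, and_comm]

section
variable {R S : IRel n} {u v w : Fin n}

theorem incClosure.le (h : incClosure R S u v) : u ≤ v := by
  induction h with
  | single h => exact h.elim And.left And.left
  | tail _ h ih => exact ih.trans (h.elim And.left And.left)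

theorem incClosure.trans (h : incClosure R S u v) (k : incClosure R S v w) :
    incClosure R S u w := Relation.TransGen.trans h k

theorem incClosure_left (h : u ≤ v) (k : R u v) : incClosure R S u v := .single (.inl ⟨h, k⟩)

theorem incClosure_right (h : u ≤ v) (k : S u v) : incClosure R S u v := .single (.inr ⟨h, k⟩)

theorem preMeet_iff_of_le (hR : ∀ u, R u u) (h : u ≤ v) :
    preMeet R S u v ↔ incClosure R S u v := by
  refine ⟨fun k => k.elim id fun k => ?_, .inl⟩
  obtain rfl := le_antisymm h k.1.1
  exact incClosure_left le_rfl (hR u)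

theorem preMeet_iff_of_lt (h : v < u) : preMeet R S u v ↔ R u v ∧ S u v :=
  ⟨fun k => k.elim (fun k => absurd k.le (not_le.2 h)) fun k => ⟨k.1.2, k.2.2⟩,
    fun k => .inr ⟨⟨h.le, k.1⟩, ⟨h.le, k.2⟩⟩⟩

theorem meetT_iff_of_le (hR : ∀ u, R u u) (h : u ≤ v) :
    meetT R S u v ↔ incClosure R S u v := by
  rw [meetT_eq, ← preMeet_iff_of_le hR h]
  refine ⟨And.left, fun k => ⟨k, ?_⟩⟩
  rintro ⟨hvu, i, j, hi, hj, h1, -, h3, h4⟩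
  -- The diagonal counts as decreasing, so it is exposed to deletion; it survives because the
  -- closure is transitive.
  obtain rfl := le_antisymm h hvu
  rw [preMeet_iff_of_le hR hi] at h1
  rw [preMeet_iff_of_le hR hj] at h3
  exact h4 (.inl (h1.trans h3))

/-- The bounds `i ≤ b` and `a ≤ j` in `tdd` make the two outer pairs increasing, so the deletion
test only involves chains of the closure. -/
theorem meetT_iff_of_lt (hR : ∀ u, R u u) (h : v < u) :
    meetT R S u v ↔ (R u v ∧ S u v) ∧
      ∀ i j, incClosure R S i u → incClosure R S v j → preMeet R S i j := by
  rw [meetT_eq, ← preMeet_iff_of_lt h]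
  constructor
  · rintro ⟨k, l⟩
    refine ⟨k, fun i j hi hj => ?_⟩
    by_contra hij
    exact l ⟨h.le, i, j, hi.le, hj.le, .inl hi, k, .inl hj, hij⟩
  · rintro ⟨k, l⟩
    refine ⟨k, ?_⟩
    rintro ⟨-, i, j, hi, hj, h1, -, h3, h4⟩
    rw [preMeet_iff_of_le hR hi] at h1
    rw [preMeet_iff_of_le hR hj] at h3
    exact h4 (l i j h1 h3)

end

/-! ### The weak order on integer posets is a lattice -/

/-- A composite with one decreasing factor is obtained from the survival test of that factor with a
trivial chain at one end. For two decreasing factors, the test of either one applies as soon as a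
chain reaches past the middle element; otherwise all pairs are decreasing and transitivity of `R`
and `S` suffices. -/
theorem meetT_mem_IPos {R S : IRel n} (hR : R ∈ IPos n) (hS : S ∈ IPos n) :
    meetT R S ∈ IPos n := by
  have self (u : Fin n) : incClosure R S u u := incClosure_left le_rfl (hR.1 u)
  refine ⟨fun u => (meetT_iff_of_le hR.1 le_rfl).2 (self u), ?_, ?_⟩
  · intro u v w huv hvw
    rcases le_or_gt u v with h | h <;> rcases le_or_gt v w with k | k
    · rw [meetT_iff_of_le hR.1 h] at huv
      rw [meetT_iff_of_le hR.1 k] at hvw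
      exact (meetT_iff_of_le hR.1 (h.trans k)).2 (huv.trans hvw)
    · rw [meetT_iff_of_le hR.1 h] at huv
      rw [meetT_iff_of_lt hR.1 k] at hvw
      have := hvw.2 u w huv (self w)
      rcases le_or_gt u w with l | l
      · rwa [meetT_iff_of_le hR.1 l, ← preMeet_iff_of_le hR.1 l]
      · rw [meetT_iff_of_lt hR.1 l]
        exact ⟨(preMeet_iff_of_lt l).1 this, fun i j hi hj => hvw.2 i j (hi.trans huv) hj⟩
    · rw [meetT_iff_of_le hR.1 k] at hvw
      rw [meetT_iff_of_lt hR.1 h] at huv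
      have := huv.2 u w (self u) hvw
      rcases le_or_gt u w with l | l
      · rwa [meetT_iff_of_le hR.1 l, ← preMeet_iff_of_le hR.1 l]
      · rw [meetT_iff_of_lt hR.1 l]
        exact ⟨(preMeet_iff_of_lt l).1 this, fun i j hi hj => huv.2 i j hi (hvw.trans hj)⟩
    · rw [meetT_iff_of_lt hR.1 k] at hvw
      rw [meetT_iff_of_lt hR.1 h] at huv
      rw [meetT_iff_of_lt hR.1 (k.trans h)]
      refine ⟨⟨hR.2.1 _ _ _ huv.1.1 hvw.1.1, hS.2.1 _ _ _ huv.1.2 hvw.1.2⟩, fun i j hi hj => ?_⟩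
      have hiv := huv.2 i v hi (self v)
      have hvj := hvw.2 v j (self v) hj
      rcases le_or_gt i v with l | l
      · exact hvw.2 i j ((preMeet_iff_of_le hR.1 l).1 hiv) hj
      rcases le_or_gt v j with m | m
      · exact huv.2 i j hi ((preMeet_iff_of_le hR.1 m).1 hvj)
      rw [preMeet_iff_of_lt l] at hiv
      rw [preMeet_iff_of_lt m] at hvj
      rw [preMeet_iff_of_lt (m.trans l)]
      exact ⟨hR.2.1 _ _ _ hiv.1 hvj.1, hS.2.1 _ _ _ hiv.2 hvj.2⟩
  · have key (u v : Fin n) (h : u < v) (huv : meetT R S u v) (hvu : meetT R S v u) : False := by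
      rw [meetT_iff_of_le hR.1 h.le] at huv
      rw [meetT_iff_of_lt hR.1 h] at hvu
      -- The survival test of `(v, u)` with the chains `v → v` and `u → y` puts `(v, y)` in both `R`
      -- and `S`, against the last proper step `y → v` of the chain.
      have step (y : Fin n) (huy : incClosure R S u y) (hyv : y < v)
          (hy : inc R y v ∨ inc S y v) : False := by
        have := (preMeet_iff_of_lt hyv).1 (hvu.2 v y (self v) huy)
        rcases hy with hy | hy
        · exact hyv.ne (hR.2.2 _ _ hy.2 this.1)
        · exact hyv.ne (hS.2.2 _ _ hy.2 this.2)
      obtain ⟨y, huy, hyv, hy⟩ : ∃ y, incClosure R S u y ∧ y < v ∧ (inc R y v ∨ inc S y v) := by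
        clear hvu step
        induction huv with
        | single hy => exact ⟨u, self u, h, hy⟩
        | @tail b c hub hbc ih =>
          rcases (hbc.elim And.left And.left : b ≤ c).lt_or_eq with l | rfl
          · exact ⟨b, hub, l, hbc⟩
          · exact ih h
      exact step y huy hyv hy
    intro u v huv hvu
    rcases lt_trichotomy u v with h | h | h
    · exact (key u v h huv hvu).elim
    · exact h
    · exact (key v u h hvu huv).elim

/-- For the greatest lower bound, the survival test is checked by extending the chains one step at a
time. A step that turns a decreasing pair into an increasing one stays within `R` or within `S`,
because decreasing pairs belong to both. Pairs that remain decreasing come from `T`. -/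
theorem le_meetT_iff {R S T : IRel n} (hR : R ∈ IPos n) (hS : S ∈ IPos n) (hT : T ∈ IPos n) :
    T ≤ meetT R S ↔ T ≤ R ∧ T ≤ S := by
  constructor
  · intro h
    have hR' : meetT R S ≤ R := by
      refine ⟨fun a b k => ⟨k.1, (meetT_iff_of_le hR.1 k.1).2 (incClosure_left k.1 k.2)⟩,
        fun a b k => ⟨k.1, ?_⟩⟩
      rcases k.1.lt_or_eq with l | rfl
      · exact ((meetT_iff_of_lt hR.1 l).1 k.2).1.1
      · exact hR.1 _
    have hS' : meetT R S ≤ S := by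
      refine ⟨fun a b k => ⟨k.1, (meetT_iff_of_le hR.1 k.1).2 (incClosure_right k.1 k.2)⟩,
        fun a b k => ⟨k.1, ?_⟩⟩
      rcases k.1.lt_or_eq with l | rfl
      · exact ((meetT_iff_of_lt hR.1 l).1 k.2).1.2
      · exact hS.1 _
    exact ⟨h.trans hR', h.trans hS'⟩
  · rintro ⟨hTR, hTS⟩
    have hI {u v : Fin n} (h : incClosure R S u v) : T u v := by
      have one {u v : Fin n} (h : inc R u v ∨ inc S u v) : T u v :=
        h.elim (fun h => (hTR.1 _ _ h).2) fun h => (hTS.1 _ _ h).2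
      induction h with
      | single h => exact one h
      | tail _ h ih => exact hT.2.1 _ _ _ ih (one h)
    have hD {u v : Fin n} (h : v < u) (k : T u v) : R u v ∧ S u v :=
      ⟨(hTR.2 _ _ ⟨h.le, k⟩).2, (hTS.2 _ _ ⟨h.le, k⟩).2⟩
    have right {b a j : Fin n} (hab : a < b) (hba : T b a) (haj : incClosure R S a j) :
        preMeet R S b j := by
      have step {y j : Fin n} (hby : preMeet R S b y) (hyj : inc R y j ∨ inc S y j)
          (hbj : T b j) : preMeet R S b j := by
        rcases le_or_gt b y with l | l
        · exact .inl (((preMeet_iff_of_le hR.1 l).1 hby).trans (.single hyj))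
        rcases le_or_gt b j with m | m
        · rw [preMeet_iff_of_le hR.1 m]
          rw [preMeet_iff_of_lt l] at hby
          rcases hyj with k | k
          · exact incClosure_left m (hR.2.1 _ _ _ hby.1 k.2)
          · exact incClosure_right m (hS.2.1 _ _ _ hby.2 k.2)
        · exact (preMeet_iff_of_lt m).2 (hD m hbj)
      induction haj with
      | single h =>
        exact step ((preMeet_iff_of_lt hab).2 (hD hab hba)) h
          (hT.2.1 _ _ _ hba (hI (.single h)))
      | tail h0 h ih => exact step ih h (hT.2.1 _ _ _ hba (hI (h0.tail h)))
    have both {i b a j : Fin n} (hab : a < b) (hba : T b a) (hib : incClosure R S i b)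
        (haj : incClosure R S a j) : preMeet R S i j := by
      have step {i z : Fin n} (hzj : preMeet R S z j) (hiz : inc R i z ∨ inc S i z)
          (hij : T i j) : preMeet R S i j := by
        rcases le_or_gt z j with l | l
        · exact .inl (.trans (.single hiz) ((preMeet_iff_of_le hR.1 l).1 hzj))
        rcases le_or_gt i j with m | m
        · rw [preMeet_iff_of_le hR.1 m]
          rw [preMeet_iff_of_lt l] at hzj
          rcases hiz with k | k
          · exact incClosure_left m (hR.2.1 _ _ _ k.2 hzj.1)
          · exact incClosure_right m (hS.2.1 _ _ _ k.2 hzj.2)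
        · exact (preMeet_iff_of_lt m).2 (hD m hij)
      have hbj := hT.2.1 _ _ _ hba (hI haj)
      induction hib using Relation.TransGen.head_induction_on with
      | single h => exact step (right hab hba haj) h (hT.2.1 _ _ _ (hI (.single h)) hbj)
      | head h h0 ih => exact step ih h (hT.2.1 _ _ _ (hI (.head h h0)) hbj)
    refine ⟨fun a b k => ⟨k.1, hI ((meetT_iff_of_le hR.1 k.1).1 k.2)⟩, fun b a k => ⟨k.1, ?_⟩⟩
    rcases k.1.lt_or_eq with l | rfl
    · exact (meetT_iff_of_lt hR.1 l).2 ⟨hD l k.2, fun i j hi hj => both l k.2 hi hj⟩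
    · exact (meetT_iff_of_le hR.1 le_rfl).2 (incClosure_left le_rfl (hR.1 _))

theorem joinT_mem_IPos {R S : IRel n} (hR : R ∈ IPos n) (hS : S ∈ IPos n) :
    joinT R S ∈ IPos n := by
  rw [joinT_eq_op_meetT]
  exact op_mem_IPos (meetT_mem_IPos (op_mem_IPos hR) (op_mem_IPos hS))

theorem joinT_le_iff {R S T : IRel n} (hR : R ∈ IPos n) (hS : S ∈ IPos n) (hT : T ∈ IPos n) :
    joinT R S ≤ T ↔ R ≤ T ∧ S ≤ T := by
  rw [joinT_eq_op_meetT, ← IRel.op_le_op, IRel.op_op,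
    le_meetT_iff (op_mem_IPos hR) (op_mem_IPos hS) (op_mem_IPos hT), IRel.op_le_op,
    IRel.op_le_op]

theorem isLatticeUnderMeetTJoinT_IPos : IsLatticeUnderMeetTJoinT (IPos n) := fun _ hR _ hS =>
  ⟨⟨meetT_mem_IPos hR hS, fun _ hT => le_meetT_iff hR hS hT⟩,
    ⟨joinT_mem_IPos hR hS, fun _ hT => joinT_le_iff hR hS hT⟩⟩

/-! ### A combinatorial description of permutree element posets -/

/-- `b` lies strictly between `a` and `c`. -/
def Btw (a b c : Fin n) : Prop := (a < b ∧ b < c) ∨ (c < b ∧ b < a)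

theorem Btw.symm {a b c : Fin n} (h : Btw a b c) : Btw c b a := Or.symm h

/-- The combinatorial conditions which characterize permutree element posets. -/
structure IsPEP (δ : PermutreeOrientation n) (R : IRel n) : Prop where
  mem_IPos : R ∈ IPos n
  neg {a b c : Fin n} : b ∈ δ.neg → Btw a b c → R a c → R b c
  pos {a b c : Fin n} : b ∈ δ.pos → Btw a b c → R a c → R a b
  link {a c : Fin n} : a ≠ c →
    R a c ∨ R c a ∨ ∃ b, Btw a b c ∧ (b ∈ δ.neg ∧ R a b ∨ b ∈ δ.pos ∧ R b a)

/-- The orientation with both subsets exchanged. -/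
def PermutreeOrientation.op (δ : PermutreeOrientation n) : PermutreeOrientation n :=
  ⟨δ.neg, δ.pos⟩

theorem PermutreeOrientation.IsCovering.op {δ : PermutreeOrientation n} (h : δ.IsCovering) :
    δ.op.IsCovering := fun i hi hi' => (h i hi hi').symm

theorem PermutreeOrientation.IsCovering.of_btw {δ : PermutreeOrientation n}
    (hδ : δ.IsCovering) {a b c : Fin n} (h : Btw a b c) : b ∈ δ.pos ∨ b ∈ δ.neg := by
  refine hδ b ?_ ?_ <;> rcases h with h | h <;> simp only [Fin.lt_def] at h <;> omega

section
variable {δ : PermutreeOrientation n} {R S : IRel n}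

theorem IsPEP.refl (h : IsPEP δ R) (u : Fin n) : R u u := h.mem_IPos.1 u

theorem IsPEP.trans (h : IsPEP δ R) {u v w : Fin n} (k : R u v) (l : R v w) : R u w :=
  h.mem_IPos.2.1 u v w k l

theorem IsPEP.antisymm (h : IsPEP δ R) {u v : Fin n} (k : R u v) (l : R v u) : u = v :=
  h.mem_IPos.2.2 u v k l

theorem IsPEP.op (h : IsPEP δ R) : IsPEP δ.op R.op where
  mem_IPos := op_mem_IPos h.mem_IPos
  neg hb k l := h.pos hb k.symm l
  pos hb k l := h.neg hb k.symm l
  link hac := by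
    rcases h.link hac with k | k | ⟨b, k, l | l⟩
    · exact .inr (.inl k)
    · exact .inl k
    · exact .inr (.inr ⟨b, k, .inr l⟩)
    · exact .inr (.inr ⟨b, k, .inl l⟩)

/-- It suffices to check the last condition on increasing pairs. -/
theorem IsPEP.of_link_lt (hR : R ∈ IPos n)
    (neg : ∀ {a b c : Fin n}, b ∈ δ.neg → Btw a b c → R a c → R b c)
    (pos : ∀ {a b c : Fin n}, b ∈ δ.pos → Btw a b c → R a c → R a b)
    (link : ∀ {a c : Fin n}, a < c →
      R a c ∨ R c a ∨ ∃ b, a < b ∧ b < c ∧ (b ∈ δ.neg ∧ R a b ∨ b ∈ δ.pos ∧ R b a)) :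
    IsPEP δ R where
  mem_IPos := hR
  neg := neg
  pos := pos
  link := by
    -- The third condition looks at the pair from one end. To look from the other end `c`, the
    -- separating label `b` seen from `a` is compared with `c` by induction: either `b` serves
    -- again, or a label between `b` and `c` does, or `a` and `c` are comparable.
    have key (k : ℕ) : ∀ a c : Fin n, a < c → c.val - a.val = k → R a c ∨ R c a ∨
        ∃ b, a < b ∧ b < c ∧ (b ∈ δ.neg ∧ R c b ∨ b ∈ δ.pos ∧ R b c) := by
      induction k using Nat.strong_induction_on with
      | _ k ih =>
        intro a c hac hk
        rcases link hac with h | h | ⟨b, hab, hbc, h⟩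
        · exact .inl h
        · exact .inr (.inl h)
        have hr := ih (c.val - b.val) (by simp only [Fin.lt_def] at hab hbc; omega) b c hbc rfl
        rcases hr with l | l | ⟨e, hbe, hec, l⟩
        · rcases h with h | h
          · exact .inl (hR.2.1 _ _ _ h.2 l)
          · exact .inr (.inr ⟨b, hab, hbc, .inr ⟨h.1, l⟩⟩)
        · rcases h with h | h
          · exact .inr (.inr ⟨b, hab, hbc, .inl ⟨h.1, l⟩⟩)
          · exact .inr (.inl (hR.2.1 _ _ _ l h.2))
        · exact .inr (.inr ⟨e, hab.trans hbe, hec, l⟩)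
    intro a c hac
    rcases lt_or_gt_of_ne hac with h | h
    · rcases link h with k | k | ⟨b, hab, hbc, k⟩
      · exact .inl k
      · exact .inr (.inl k)
      · exact .inr (.inr ⟨b, .inl ⟨hab, hbc⟩, k⟩)
    · rcases key _ c a h rfl with k | k | ⟨b, hab, hbc, k⟩
      · exact .inr (.inl k)
      · exact .inl k
      · exact .inr (.inr ⟨b, .inr ⟨hab, hbc⟩, k⟩)

/-! ### Meets and joins -/

theorem incClosure_neg (hR : IsPEP δ R) (hS : IsPEP δ S) {a b c : Fin n} (hb : b ∈ δ.neg)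
    (hab : a < b) (hbc : b < c) (h : incClosure R S a c) : incClosure R S b c := by
  induction h with
  | single h =>
    rcases h with h | h
    · exact incClosure_left hbc.le (hR.neg hb (.inl ⟨hab, hbc⟩) h.2)
    · exact incClosure_right hbc.le (hS.neg hb (.inl ⟨hab, hbc⟩) h.2)
  | @tail y z h k ih =>
    rcases lt_trichotomy b y with l | rfl | l
    · exact (ih l).tail k
    · exact .single k
    · rcases k with k | k
      · exact incClosure_left hbc.le (hR.neg hb (.inl ⟨l, hbc⟩) k.2)
      · exact incClosure_right hbc.le (hS.neg hb (.inl ⟨l, hbc⟩) k.2)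

theorem incClosure_pos (hR : IsPEP δ R) (hS : IsPEP δ S) {a b c : Fin n} (hb : b ∈ δ.pos)
    (hab : a < b) (hbc : b < c) (h : incClosure R S a c) : incClosure R S a b := by
  induction h with
  | single h =>
    rcases h with h | h
    · exact incClosure_left hab.le (hR.pos hb (.inl ⟨hab, hbc⟩) h.2)
    · exact incClosure_right hab.le (hS.pos hb (.inl ⟨hab, hbc⟩) h.2)
  | @tail y z h k ih =>
    rcases lt_trichotomy b y with l | rfl | l
    · exact ih l
    · exact h
    · refine h.tail ?_
      rcases k with k | k
      · exact .inl ⟨l.le, hR.pos hb (.inl ⟨l, hbc⟩) k.2⟩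
      · exact .inr ⟨l.le, hS.pos hb (.inl ⟨l, hbc⟩) k.2⟩

/-- Let `u → y` be the first step of the chain. If `y` is strictly between, then `y ∈ δ⁺` gives `v →
y` in both relations and the chain gets shorter, while `y ∈ δ⁻` gives `y → u` in both, contradicting
the first step. -/
theorem incClosure_disjoint (hδ : δ.IsCovering) (hR : IsPEP δ R) (hS : IsPEP δ S)
    {u v : Fin n} (huv : u < v) (h : incClosure R S u v) (k : R v u ∧ S v u) : False := by
  induction h using Relation.TransGen.head_induction_on with
  | single h =>
    rcases h with h | h
    · exact huv.ne (hR.antisymm h.2 k.1)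
    · exact huv.ne (hS.antisymm h.2 k.2)
  | @head u y h h0 ih =>
    rcases (h.elim And.left And.left : u ≤ y).lt_or_eq with l | rfl
    · rcases (incClosure.le h0).lt_or_eq with m | rfl
      · have hy : Btw v y u := .inr ⟨l, m⟩
        rcases hδ.of_btw hy with hp | hn
        · exact ih m ⟨hR.pos hp hy k.1, hS.pos hp hy k.2⟩
        · rcases h with h | h
          · exact l.ne (hR.antisymm h.2 (hR.neg hn hy k.1))
          · exact l.ne (hS.antisymm h.2 (hS.neg hn hy k.2))
      · rcases h with h | h
        · exact l.ne (hR.antisymm h.2 k.1)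
        · exact l.ne (hS.antisymm h.2 k.2)
    · exact ih huv k

theorem preMeet_neg (hR : IsPEP δ R) (hS : IsPEP δ S) {a b c : Fin n} (hb : b ∈ δ.neg)
    (h : Btw a b c) (k : preMeet R S a c) : preMeet R S b c := by
  rcases h with ⟨hab, hbc⟩ | ⟨hcb, hba⟩
  · rw [preMeet_iff_of_le hR.refl (hab.trans hbc).le] at k
    exact .inl (incClosure_neg hR hS hb hab hbc k)
  · rw [preMeet_iff_of_lt (hcb.trans hba)] at k
    exact (preMeet_iff_of_lt hcb).2
      ⟨hR.neg hb (.inr ⟨hcb, hba⟩) k.1, hS.neg hb (.inr ⟨hcb, hba⟩) k.2⟩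

theorem preMeet_pos (hR : IsPEP δ R) (hS : IsPEP δ S) {a b c : Fin n} (hb : b ∈ δ.pos)
    (h : Btw a b c) (k : preMeet R S a c) : preMeet R S a b := by
  rcases h with ⟨hab, hbc⟩ | ⟨hcb, hba⟩
  · rw [preMeet_iff_of_le hR.refl (hab.trans hbc).le] at k
    exact .inl (incClosure_pos hR hS hb hab hbc k)
  · rw [preMeet_iff_of_lt (hcb.trans hba)] at k
    exact (preMeet_iff_of_lt hba).2
      ⟨hR.pos hb (.inr ⟨hcb, hba⟩) k.1, hS.pos hb (.inr ⟨hcb, hba⟩) k.2⟩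

theorem preMeet_antisymm (hδ : δ.IsCovering) (hR : IsPEP δ R) (hS : IsPEP δ S) {u v : Fin n}
    (h : preMeet R S u v) (k : preMeet R S v u) : u = v := by
  have key {u v : Fin n} (huv : u < v) (h : preMeet R S u v) (k : preMeet R S v u) : False :=
    incClosure_disjoint hδ hR hS huv ((preMeet_iff_of_le hR.refl huv.le).1 h)
      ((preMeet_iff_of_lt huv).1 k)
  rcases lt_trichotomy u v with l | l | l
  · exact (key l h k).elim
  · exact l
  · exact (key l k h).elim

/-- If `w` lies between `u` and `v`, the orientation at `w` yields either `u → w` or `w → v`, and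
the latter contradicts `v → w`. The case of `u` in the middle is similar. If `v` is in the middle,
both pairs have the same direction. -/
theorem preMeet_trans (hδ : δ.IsCovering) (hR : IsPEP δ R) (hS : IsPEP δ S) {u v w : Fin n}
    (h : preMeet R S u v) (k : preMeet R S v w) : preMeet R S u w := by
  by_cases huw : Btw u w v
  · rcases hδ.of_btw huw with hp | hn
    · exact preMeet_pos hR hS hp huw h
    · have := preMeet_antisymm hδ hR hS (preMeet_neg hR hS hn huw h) k
      rcases huw with huw | huw <;> order
  by_cases hvu : Btw v u w
  · rcases hδ.of_btw hvu with hp | hn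
    · have := preMeet_antisymm hδ hR hS (preMeet_pos hR hS hp hvu k) h
      rcases hvu with hvu | hvu <;> order
    · exact preMeet_neg hR hS hn hvu k
  rcases eq_or_ne u v with rfl | huv
  · exact k
  rcases eq_or_ne v w with rfl | hvw
  · exact h
  rcases eq_or_ne u w with rfl | hne
  · exact absurd (preMeet_antisymm hδ hR hS h k) huv
  rcases lt_or_gt_of_ne huv with l | l
  · have m : v < w := by
      by_contra m
      simp only [Btw] at huw hvu
      grind
    rw [preMeet_iff_of_le hR.refl l.le] at h
    rw [preMeet_iff_of_le hR.refl m.le] at k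
    exact .inl (h.trans k)
  · have m : w < v := by
      by_contra m
      simp only [Btw] at huw hvu
      grind
    rw [preMeet_iff_of_lt l] at h
    rw [preMeet_iff_of_lt m] at k
    exact (preMeet_iff_of_lt (m.trans l)).2 ⟨hR.trans h.1 k.1, hS.trans h.2 k.2⟩

/-- By symmetry `R` does not contain `c → a`. Suppose that no increasing chain leads from `a` to `c`
or to a label of `δ⁻` in between. Then the link of `a` and `c` in `R` is some `b ∈ δ⁺` with `b → a`.
For the largest such `b`, the link of `b` and `c` must be an increasing `b → e` with `e = c` or `e ∈
δ⁻`. -/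
theorem preMeet_link (hR : IsPEP δ R) (hS : IsPEP δ S) (k : ℕ) : ∀ {a c : Fin n}, a < c →
    c.val - a.val = k → preMeet R S a c ∨ preMeet R S c a ∨
      ∃ b, a < b ∧ b < c ∧ (b ∈ δ.neg ∧ preMeet R S a b ∨ b ∈ δ.pos ∧ preMeet R S b a) := by
  induction k using Nat.strong_induction_on with
  | _ k ih =>
    have key {R S : IRel n} (hR : IsPEP δ R) (hS : IsPEP δ S)
        (ih : ∀ m < k, ∀ {a c : Fin n}, a < c → c.val - a.val = m →
          preMeet R S a c ∨ preMeet R S c a ∨ ∃ b, a < b ∧ b < c ∧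
            (b ∈ δ.neg ∧ preMeet R S a b ∨ b ∈ δ.pos ∧ preMeet R S b a))
        {a c : Fin n} (hac : a < c) (hk : c.val - a.val = k) (hca : ¬ R c a) :
        preMeet R S a c ∨ preMeet R S c a ∨
          ∃ b, a < b ∧ b < c ∧ (b ∈ δ.neg ∧ preMeet R S a b ∨ b ∈ δ.pos ∧ preMeet R S b a) := by
      by_cases hI : ∃ b, a < b ∧ b ≤ c ∧ (b = c ∨ b ∈ δ.neg) ∧ preMeet R S a b
      · obtain ⟨b, hab, hbc, hb, h⟩ := hI
        rcases hbc.lt_or_eq with l | rfl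
        · exact .inr (.inr ⟨b, hab, l, .inl ⟨hb.resolve_left l.ne, h⟩⟩)
        · exact .inl h
      push Not at hI
      refine .inr (.inr ?_)
      obtain ⟨b, e, hab, hbc, hb, hba, hbe, hec, he, hbe'⟩ : ∃ b e : Fin n, a < b ∧ b < c ∧
          b ∈ δ.pos ∧ R b a ∧ b < e ∧ e ≤ c ∧ (e = c ∨ e ∈ δ.neg) ∧ R b e := by
        have hI' {b : Fin n} (hab : a < b) (hbc : b ≤ c) (hb : b = c ∨ b ∈ δ.neg) : ¬ R a b :=
          fun h => hI b hab hbc hb (.inl (incClosure_left hab.le h))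
        have good : ∃ b, (a < b ∧ b < c ∧ b ∈ δ.pos ∧ R b a) ∧
            ∀ d, (a < d ∧ d < c ∧ d ∈ δ.pos ∧ R d a) → d ≤ b := by
          refine (Set.toFinite {b | a < b ∧ b < c ∧ b ∈ δ.pos ∧ R b a}).exists_maximal ?_ |>.imp
            fun b h => ⟨h.1, fun d hd => ?_⟩
          · rcases hR.link hac.ne with h | h | ⟨b, hb, h | h⟩
            · exact absurd h (hI' hac le_rfl (.inl rfl))
            · exact absurd h hca
            · rcases hb with hb | hb
              · exact absurd h.2 (hI' hb.1 hb.2.le (.inr h.1))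
              · order
            · rcases hb with hb | hb
              · exact ⟨b, hb.1, hb.2, h⟩
              · order
          · by_contra hlt
            exact hlt (h.2 hd (not_le.1 hlt).le)
        obtain ⟨b, ⟨hab, hbc, hb, hba⟩, hmax⟩ := good
        refine ⟨b, ?_⟩
        rcases hR.link hbc.ne with h | h | ⟨e, he, h | h⟩
        · exact ⟨c, hab, hbc, hb, hba, hbc, le_rfl, .inl rfl, h⟩
        · exact absurd (hR.trans h hba) hca
        · rcases he with he | he
          · exact ⟨e, hab, hbc, hb, hba, he.1, he.2.le, .inr h.1, h.2⟩
          · order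
        · rcases he with he | he
          · exact absurd (hmax e ⟨hab.trans he.1, he.2, h.1, hR.trans h.2 hba⟩) (not_le.2 he.1)
          · order
      -- Induction on the pair `a < b`: an increasing chain `a → b` could be prolonged to `e`, which
      -- is excluded, and both other outcomes provide a separating label.
      have hlt : b.val - a.val < k := by simp only [Fin.lt_def] at hab hbc; omega
      rcases ih _ hlt hab rfl with h | h | ⟨d, had, hdb, h⟩
      · rw [preMeet_iff_of_le hR.refl hab.le] at h
        exact absurd (.inl (h.trans (incClosure_left hbe.le hbe'))) (hI e (hab.trans hbe) hec he)
      · exact ⟨b, hab, hbc, .inr ⟨hb, h⟩⟩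
      · exact ⟨d, had, hdb.trans hbc, h⟩
    intro a c hac hk
    by_cases hRc : R c a
    · by_cases hSc : S c a
      · exact .inr (.inl ((preMeet_iff_of_lt hac).2 ⟨hRc, hSc⟩))
      · simp only [preMeet_comm R S] at ih ⊢
        exact key hS hR ih hac hk hSc
    · exact key hR hS ih hac hk hRc

theorem isPEP_preMeet (hδ : δ.IsCovering) (hR : IsPEP δ R) (hS : IsPEP δ S) :
    IsPEP δ (preMeet R S) :=
  .of_link_lt
    ⟨fun u => .inl (incClosure_left le_rfl (hR.refl u)),
      fun _ _ _ => preMeet_trans hδ hR hS, fun _ _ => preMeet_antisymm hδ hR hS⟩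
    (preMeet_neg hR hS) (preMeet_pos hR hS) (fun h => preMeet_link hR hS _ h rfl)

theorem tdd_eq_self {M : IRel n} (h : ∀ u v w, M u v → M v w → M u w) : tdd M = M := by
  funext b a
  apply propext
  refine ⟨And.left, fun k => ⟨k, ?_⟩⟩
  rintro ⟨-, i, j, -, -, h1, h2, h3, h4⟩
  exact h4 (h _ _ _ (h _ _ _ h1 h2) h3)

/-- The deletion `tdd` is vacuous on a transitive relation, so the meet is `preMeet` itself. -/
theorem IsPEP.meetT (hδ : δ.IsCovering) (hR : IsPEP δ R) (hS : IsPEP δ S) :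
    IsPEP δ (meetT R S) := by
  rw [meetT_eq, tdd_eq_self (M := preMeet R S) fun _ _ _ => preMeet_trans hδ hR hS]
  exact isPEP_preMeet hδ hR hS

theorem IsPEP.joinT (hδ : δ.IsCovering) (hR : IsPEP δ R) (hS : IsPEP δ S) :
    IsPEP δ (joinT R S) := by
  rw [joinT_eq_op_meetT]
  exact (IsPEP.meetT hδ.op hR.op hS.op).op

end

/-! ### Cover relations -/

/-- The cover relation of a partial order. -/
def coverRel (R : IRel n) : Fin n → Fin n → Prop := fun i j =>
  i ≠ j ∧ R i j ∧ ∀ k, R i k → R k j → k = i ∨ k = j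

theorem coverRel_op {R : IRel n} {i j : Fin n} : coverRel R.op i j ↔ coverRel R j i :=
  ⟨fun h => ⟨h.1.symm, h.2.1, fun k hk hk' => (h.2.2 k hk' hk).symm⟩,
    fun h => ⟨h.1.symm, h.2.1, fun k hk hk' => (h.2.2 k hk' hk).symm⟩⟩

theorem reflTransGen_coverRel {R : IRel n} (hR : R ∈ IPos n) :
    Relation.ReflTransGen (coverRel R) = R := by
  obtain ⟨refl, trans, antisymm⟩ := hR
  funext a b
  apply propext
  constructor
  · intro h
    induction h with
    | refl => exact refl a
    | tail _ h ih => exact trans _ _ _ ih h.2.1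
  · have key (m : ℕ) : ∀ a b, R a b → {k | R a k ∧ R k b}.ncard = m →
        Relation.ReflTransGen (coverRel R) a b := by
      induction m using Nat.strong_induction_on with
      | _ m ih =>
        intro a b hab hm
        by_cases hne : a = b
        · exact hne ▸ .refl
        by_cases hc : coverRel R a b
        · exact .single hc
        obtain ⟨k, hak, hkb, hka, hkb'⟩ : ∃ k, R a k ∧ R k b ∧ k ≠ a ∧ k ≠ b := by
          by_contra hk
          push Not at hk
          exact hc ⟨hne, hab, fun k h h' => or_iff_not_imp_left.2 (hk k h h')⟩
        refine (ih _ ?_ a k hak rfl).trans (ih _ ?_ k b hkb rfl)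
        · rw [← hm]
          refine Set.ncard_lt_ncard ⟨fun x hx => ⟨hx.1, trans _ _ _ hx.2 hkb⟩, fun h => ?_⟩
          exact hkb' (antisymm _ _ hkb (h (⟨hab, refl b⟩ : b ∈ {k | R a k ∧ R k b})).2)
        · rw [← hm]
          refine Set.ncard_lt_ncard ⟨fun x hx => ⟨trans _ _ _ hak hx.1, hx.2⟩, fun h => ?_⟩
          exact hka (antisymm _ _ (h (⟨refl a, hab⟩ : a ∈ {k | R a k ∧ R k b})).1 hak)
    exact fun h => key _ a b h rfl

/-! ### The two sides of a vertex -/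

/-- The vertices which are seen from `v` through one of its parents. -/
def upSide (δ : PermutreeOrientation n) (R : IRel n) (v : Fin n) : Set (Fin n) :=
  {w | w ≠ v ∧ ∃ b, (b = w ∨ Btw v b w ∧ b ∈ δ.neg) ∧ R v b}

/-- The vertices which are seen from `v` through one of its children. -/
def downSide (δ : PermutreeOrientation n) (R : IRel n) (v : Fin n) : Set (Fin n) :=
  {w | w ≠ v ∧ ∃ b, (b = w ∨ Btw v b w ∧ b ∈ δ.pos) ∧ R b v}

section
variable {δ : PermutreeOrientation n} {R : IRel n}

/-- Of the two witnesses, the one nearer to `v` inherits the relation of the other through `neg` or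
`pos`, and then contradicts antisymmetry with its own. -/
theorem IsPEP.notMem_downSide (h : IsPEP δ R) {v w : Fin n} (hu : w ∈ upSide δ R v) :
    w ∉ downSide δ R v := by
  rintro ⟨hwv, b', hb', hbv'⟩
  obtain ⟨-, b, hb, hvb⟩ := hu
  rcases hb with rfl | ⟨hb, hbn⟩ <;> rcases hb' with rfl | ⟨hb', hbp⟩
  · exact hwv (h.antisymm hbv' hvb)
  · have := h.antisymm (h.pos hbp hb' hvb) hbv'
    rcases hb' with k | k <;> order
  · have := h.antisymm (h.neg hbn hb.symm hbv') hvb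
    rcases hb with k | k <;> order
  · rcases eq_or_ne b b' with rfl | hne
    · have := h.antisymm hvb hbv'
      rcases hb with k | k <;> order
    · by_cases hbb : Btw v b b'
      · have := h.antisymm (h.neg hbn hbb.symm hbv') hvb
        rcases hb with k | k <;> order
      · have hbb' : Btw v b' b := by
          simp only [Btw] at *
          grind
        have := h.antisymm (h.pos hbp hbb' hvb) hbv'
        rcases hb' with k | k <;> order

theorem IsPEP.mem_upSide_or (h : IsPEP δ R) {v w : Fin n} (hne : w ≠ v) :
    w ∈ upSide δ R v ∨ w ∈ downSide δ R v := by
  rcases h.link hne.symm with k | k | ⟨b, hb, k | k⟩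
  · exact .inl ⟨hne, w, .inl rfl, k⟩
  · exact .inr ⟨hne, w, .inl rfl, k⟩
  · exact .inl ⟨hne, b, .inr ⟨hb, k.1⟩, k.2⟩
  · exact .inr ⟨hne, b, .inr ⟨hb, k.1⟩, k.2⟩

theorem mem_upSide {v w : Fin n} (hne : w ≠ v) (k : R v w) : w ∈ upSide δ R v :=
  ⟨hne, w, .inl rfl, k⟩

theorem mem_downSide {v w : Fin n} (hne : w ≠ v) (k : R w v) : w ∈ downSide δ R v :=
  ⟨hne, w, .inl rfl, k⟩

/-- Three distinct elements: one of them lies between the two others. -/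
theorem btw_or_btw_or_btw {u v w : Fin n} (huv : u ≠ v) (hvw : v ≠ w) (huw : u ≠ w) :
    Btw u v w ∨ Btw v u w ∨ Btw v w u := by
  simp only [Btw]
  grind

theorem Btw.trans_left {v b w w' : Fin n} (h : Btw v b w) (k : Btw v w w') : Btw v b w' := by
  simp only [Btw] at *
  grind

/-- Whichever of `v`, `w`, `w'` is in the middle, the relation `w → w'` would move `w` to the down
side or `w'` to the up side, against disjointness. -/
theorem IsPEP.not_rel_upSide_downSide (hδ : δ.IsCovering) (h : IsPEP δ R) {v w w' : Fin n}
    (hw : w ∈ upSide δ R v) (hw' : w' ∈ downSide δ R v) : ¬ R w w' := by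
  intro k
  have hne : w ≠ w' := by
    rintro rfl
    exact h.notMem_downSide hw hw'
  obtain ⟨hwv, b, hb, hvb⟩ := id hw
  obtain ⟨hwv', b', hb', hbv'⟩ := id hw'
  rcases btw_or_btw_or_btw hwv hwv'.symm hne with l | l | l
  · rcases hδ.of_btw l with hp | hn
    · exact h.notMem_downSide hw (mem_downSide hwv (h.pos hp l k))
    · exact h.notMem_downSide (mem_upSide hwv' (h.neg hn l k)) hw'
  · rcases hδ.of_btw l with hp | hn
    · rcases hb with rfl | ⟨hb, hbn⟩
      · exact h.notMem_downSide (mem_upSide hwv' (h.trans hvb k)) hw'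
      · exact h.notMem_downSide ⟨hwv', b, .inr ⟨hb.trans_left l, hbn⟩, hvb⟩ hw'
    · refine h.notMem_downSide ⟨hwv', b, .inr ⟨?_, ?_⟩, hvb⟩ hw'
      · rcases hb with rfl | ⟨hb, hbn⟩
        · exact l
        · exact hb.trans_left l
      · rcases hb with rfl | ⟨hb, hbn⟩
        · exact hn
        · exact hbn
  · rcases hb' with rfl | ⟨hb', hbp⟩
    · exact h.notMem_downSide hw (mem_downSide hwv (h.trans k hbv'))
    · exact h.notMem_downSide hw ⟨hwv, b', .inr ⟨hb'.trans_left l, hbp⟩, hbv'⟩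

/-- Unless the two sides overlap, the relation `w' → w` factors as `w' → v → w`, so it is not a
cover. -/
theorem IsPEP.not_coverRel_downSide_upSide (hδ : δ.IsCovering) (h : IsPEP δ R)
    {v w w' : Fin n} (hw : w ∈ upSide δ R v) (hw' : w' ∈ downSide δ R v) :
    ¬ coverRel R w' w := by
  rintro ⟨hne, k, hc⟩
  obtain ⟨hwv, b, hb, hvb⟩ := id hw
  obtain ⟨hwv', b', hb', hbv'⟩ := id hw'
  have hc' (l : R w' v) (l' : R v w) : False := by
    rcases hc v l l' with rfl | rfl
    · exact hwv' rfl
    · exact hwv rfl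
  rcases btw_or_btw_or_btw hwv' hwv.symm hne with l | l | l
  · rcases hδ.of_btw l with hp | hn
    · have hwv2 := h.pos hp l k
      refine hc' hwv2 ?_
      rcases hb with rfl | ⟨hb, hbn⟩
      · exact hvb
      · refine h.trans hvb (h.neg hbn ?_ k)
        simp only [Btw] at *
        grind
    · have hwv2 := h.neg hn l k
      refine hc' ?_ hwv2
      rcases hb' with rfl | ⟨hb', hbp⟩
      · exact hbv'
      · refine h.trans (h.pos hbp ?_ k) hbv'
        simp only [Btw] at *
        grind
  · rcases hb' with rfl | ⟨hb', hbp⟩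
    swap
    · exact h.notMem_downSide hw ⟨hwv, b', .inr ⟨hb'.trans_left l, hbp⟩, hbv'⟩
    refine hc' hbv' ?_
    rcases hb with rfl | ⟨hb, hbn⟩
    · exact hvb
    have hbb : b ≠ b' := by
      rintro rfl
      exact hwv' (h.antisymm hbv' hvb)
    have : Btw v b b' ∨ Btw b' b w := by
      simp only [Btw] at *
      grind
    rcases this with m | m
    · exact absurd hw' (h.notMem_downSide ⟨hwv', b, .inr ⟨m, hbn⟩, hvb⟩)
    · exact h.trans hvb (h.neg hbn m k)
  · rcases hb with rfl | ⟨hb, hbn⟩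
    swap
    · exact h.notMem_downSide ⟨hwv', b, .inr ⟨hb.trans_left l, hbn⟩, hvb⟩ hw'
    refine hc' ?_ hvb
    rcases hb' with rfl | ⟨hb', hbp⟩
    · exact hbv'
    have hbb : b' ≠ b := by
      rintro rfl
      exact hwv (h.antisymm hbv' hvb)
    have : Btw v b' b ∨ Btw w' b' b := by
      simp only [Btw] at *
      grind
    rcases this with m | m
    · exact absurd ⟨hwv, b', .inr ⟨m, hbp⟩, hbv'⟩ (h.notMem_downSide hw)
    · exact h.trans (h.pos hbp m k) hbv'

theorem IsPEP.not_rel_upSide_of_btw (h : IsPEP δ R) {v w w' : Fin n} (hv : v ∈ δ.pos)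
    (hw : w ∈ upSide δ R v) (hb : Btw w v w') : ¬ R w w' := fun k =>
  h.notMem_downSide hw (mem_downSide hw.1 (h.pos hv hb k))

/-! ### The permutree of a relation -/

/-- Incomparable elements above `v` branch at an element of `δ⁺`. The link of `p` and `q` gives a
label between them, and strong induction on the distance is applied to the closer pairs until a
branching label has relations to both `p` and `q`. -/
theorem IsPEP.exists_branch (h : IsPEP δ R) {v p q : Fin n} (hvp : R v p) (hvq : R v q)
    (hpq : ¬ R p q) (hqp : ¬ R q p) :
    ∃ b ∈ δ.pos, Btw p b q ∧ R v b ∧ R b p ∧ R b q := by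
  have key (m : ℕ) : ∀ p q : Fin n, p < q → q.val - p.val = m → R v p → R v q → ¬ R p q →
      ¬ R q p → ∃ b ∈ δ.pos, p < b ∧ b < q ∧ R v b ∧ R b p ∧ R b q := by
    induction m using Nat.strong_induction_on with
    | _ m ih =>
      intro p q hlt hm hvp hvq hpq hqp
      have hm1 {b : Fin n} (h1 : p < b) (h2 : b < q) : q.val - b.val < m := by
        simp only [Fin.lt_def] at h1 h2; omega
      have hm2 {b : Fin n} (h1 : p < b) (h2 : b < q) : b.val - p.val < m := by
        simp only [Fin.lt_def] at h1 h2; omega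
      obtain ⟨b, hpb, hbq, hb⟩ : ∃ b, p < b ∧ b < q ∧
          (b ∈ δ.neg ∧ R p b ∨ b ∈ δ.pos ∧ R b p) := by
        rcases h.link hlt.ne with k | k | ⟨b, k | k, hb⟩
        · exact absurd k hpq
        · exact absurd k hqp
        · exact ⟨b, k.1, k.2, hb⟩
        · order
      rcases hb with ⟨hn, hpb'⟩ | ⟨hp, hbp⟩
      · have hvb : R v b := h.trans hvp hpb'
        have hbq' : ¬ R b q := fun k => hpq (h.trans hpb' k)
        by_cases hqb : R q b
        · exfalso
          -- Each position of `v` is impossible: `v → q` or `v → p` passes over `b` (or starts at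
          -- it) and gives `b → q` or `b → p`.
          rcases lt_trichotomy v b with l | rfl | l
          · exact hbq' (h.neg hn (.inl ⟨l, hbq⟩) hvq)
          · exact hbq' hvq
          · exact hpb.ne (h.antisymm hpb' (h.neg hn (.inr ⟨hpb, l⟩) hvp))
        obtain ⟨d, hd, hbd, hdq, hvd, hdb, hdq'⟩ :=
          ih _ (hm1 hpb hbq) b q hbq rfl hvb hvq hbq' hqb
        have hpd : ¬ R p d := fun k => hpq (h.trans k hdq')
        by_cases hdp : R d p
        · exact ⟨d, hd, hpb.trans hbd, hdq, hvd, hdp, hdq'⟩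
        obtain ⟨e, he, hpe, hed, hve, hep, hed'⟩ :=
          ih _ (hm2 (hpb.trans hbd) hdq) p d (hpb.trans hbd) rfl hvp hvd hpd hdp
        exact ⟨e, he, hpe, hed.trans hdq, hve, hep, h.trans hed' hdq'⟩
      · have hvb : R v b := by
          rcases lt_trichotomy v b with l | rfl | l
          · exact h.pos hp (.inl ⟨l, hbq⟩) hvq
          · exact h.refl v
          · exact h.pos hp (.inr ⟨hpb, l⟩) hvp
        have hqb : ¬ R q b := fun k => hqp (h.trans k hbp)
        by_cases hbq' : R b q
        · exact ⟨b, hp, hpb, hbq, hvb, hbp, hbq'⟩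
        obtain ⟨d, hd, hbd, hdq, hvd, hdb, hdq'⟩ :=
          ih _ (hm1 hpb hbq) b q hbq rfl hvb hvq hbq' hqb
        exact ⟨d, hd, hpb.trans hbd, hdq, hvd, h.trans hdb hbp, hdq'⟩
  rcases lt_trichotomy p q with l | rfl | l
  · obtain ⟨b, hb, h1, h2, h3⟩ := key _ p q l rfl hvp hvq hpq hqp
    exact ⟨b, hb, .inl ⟨h1, h2⟩, h3⟩
  · exact absurd (h.refl p) hpq
  · obtain ⟨b, hb, h1, h2, h3, h4, h5⟩ := key _ q p l rfl hvq hvp hqp hpq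
    exact ⟨b, hb, .inr ⟨h1, h2⟩, h3, h5, h4⟩

/-- The branching element of two covers of `v` has to be `v` itself. -/
theorem IsPEP.btw_of_coverRel (h : IsPEP δ R) {v p q : Fin n} (hp : coverRel R v p)
    (hq : coverRel R v q) (hpq : p ≠ q) : v ∈ δ.pos ∧ Btw p v q := by
  have h1 : ¬ R p q := fun k => (hq.2.2 p hp.2.1 k).elim (fun e => hp.1 e.symm) hpq
  have h2 : ¬ R q p := fun k => (hp.2.2 q hq.2.1 k).elim (fun e => hq.1 e.symm) hpq.symm
  obtain ⟨b, hb, hbt, hvb, hbp, -⟩ := h.exists_branch hp.2.1 hq.2.1 h1 h2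
  rcases hp.2.2 b hvb hbp with rfl | rfl
  · exact ⟨hb, hbt⟩
  · rcases hbt with k | k <;> order

theorem subtree_subset {G : SimpleGraph (Fin n)} {v p : Fin n} {S : Set (Fin n)} (hp : p ∈ S)
    (hS : ∀ x ∈ S, ∀ y, G.Adj x y → s(x, y) ≠ s(v, p) → y ∈ S) : subtree G v p ⊆ S := by
  intro w hw
  have hw' := (SimpleGraph.reachable_iff_reflTransGen _ _).1 hw
  induction hw' with
  | refl => exact hp
  | tail h k ih =>
    rw [SimpleGraph.deleteEdges_adj] at k
    exact hS _ (ih ((SimpleGraph.reachable_iff_reflTransGen _ _).2 h)) _ k.1 k.2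

/-- The graph underlying the permutree of a relation. -/
def coverGraph (R : IRel n) : SimpleGraph (Fin n) := SimpleGraph.fromRel (coverRel R)

theorem coverGraph_op (R : IRel n) : coverGraph R.op = coverGraph R := by
  ext a b
  simp only [coverGraph, SimpleGraph.fromRel_adj, coverRel_op, or_comm]

/-- The set on the right is closed under all edges except the one joining `v` and `p`. Edges cannot
change sides, and for `v ∈ δ⁺` an edge within the up side cannot pass over `v`. -/
theorem IsPEP.subtree_subset_upSide (hδ : δ.IsCovering) (h : IsPEP δ R) {v p : Fin n}
    (hp : coverRel R v p) :
    subtree (coverGraph R) v p ⊆ {w | w ∈ upSide δ R v ∧ (v ∈ δ.pos → (w < v ↔ p < v))} := by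
  apply subtree_subset
  · exact ⟨mem_upSide hp.1.symm hp.2.1, fun _ => Iff.rfl⟩
  rintro x ⟨hx, hxp⟩ y hxy hne
  rw [coverGraph, SimpleGraph.fromRel_adj] at hxy
  obtain ⟨-, hxy⟩ := hxy
  -- An edge back to `v` would come from a second parent `x`, which lies on the other side of `v`
  -- than `p`.
  have hyv : y ≠ v := by
    rintro rfl
    have hyx : coverRel R y x := hxy.resolve_left fun k =>
      h.notMem_downSide hx (mem_downSide hx.1 k.2.1)
    have hxp' : x ≠ p := by
      rintro rfl
      exact hne Sym2.eq_swap
    obtain ⟨h1, h2⟩ := h.btw_of_coverRel hyx hp hxp'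
    have := hxp h1
    simp only [Btw] at h2
    grind
  have hyU : y ∈ upSide δ R v := by
    refine (h.mem_upSide_or hyv).resolve_right fun hy => ?_
    rcases hxy with k | k
    · exact h.not_rel_upSide_downSide hδ hx hy k.2.1
    · exact h.not_coverRel_downSide_upSide hδ hx hy k
  refine ⟨hyU, fun hv => ?_⟩
  rw [← hxp hv]
  have hxv := hx.1
  by_contra hcross
  have hb : Btw x v y := by
    simp only [Btw]
    grind
  rcases hxy with k | k
  · exact h.not_rel_upSide_of_btw hv hx hb k.2.1
  · exact h.not_rel_upSide_of_btw hv hyU hb.symm k.2.1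

theorem IsPEP.slotCondition (hδ : δ.IsCovering) (h : IsPEP δ R) (v : Fin n) :
    SlotCondition (coverGraph R) v (v ∈ δ.pos) {p | coverRel R v p} := by
  refine ⟨fun hv p hp q hq => ?_, fun hv => ⟨fun p hp q hq hpq => ?_, ?_, ?_⟩⟩
  · by_contra hne
    exact hv (h.btw_of_coverRel hp hq hne).1
  · by_contra hne
    rcases (h.btw_of_coverRel hp hq hne).2 with k | k
    · exact absurd (hpq.1 k.1) (not_lt.2 k.2.le)
    · exact absurd (hpq.2 k.1) (not_lt.2 k.2.le)
  · intro p hp hpv w hw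
    exact ((h.subtree_subset_upSide hδ hp hw).2 hv).2 hpv
  · intro p hp hpv w hw
    obtain ⟨h1, h2⟩ := h.subtree_subset_upSide hδ hp hw
    exact lt_of_le_of_ne (not_lt.1 fun k => absurd ((h2 hv).1 k) (not_lt.2 hpv.le)) h1.1.symm

theorem IsPEP.preconnected (h : IsPEP δ R) : (coverGraph R).Preconnected := by
  have hR (a c : Fin n) (k : R a c) : (coverGraph R).Reachable a c := by
    rw [← reflTransGen_coverRel h.mem_IPos] at k
    induction k with
    | refl => exact .rfl
    | tail _ k ih => exact ih.trans (SimpleGraph.Adj.reachable ⟨k.1, .inl k⟩)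
  have key (m : ℕ) : ∀ a c : Fin n, a < c → c.val - a.val = m →
      (coverGraph R).Reachable a c := by
    induction m using Nat.strong_induction_on with
    | _ m ih =>
      intro a c hac hm
      rcases h.link hac.ne with k | k | ⟨b, hb | hb, k⟩
      · exact hR _ _ k
      · exact (hR _ _ k).symm
      · have hlt : c.val - b.val < m := by
          have := hb.1
          simp only [Fin.lt_def] at this hac
          omega
        refine SimpleGraph.Reachable.trans ?_ (ih _ hlt b c hb.2 rfl)
        rcases k with k | k
        · exact hR _ _ k.2
        · exact (hR _ _ k.2).symm
      · order
  intro a c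
  rcases lt_trichotomy a c with k | rfl | k
  · exact key _ a c k rfl
  · exact .rfl
  · exact (key _ c a k rfl).symm

/-- Since `v` is not on its own up side, it cannot be reached from a parent once their edge is
removed: every edge is a bridge. -/
theorem IsPEP.isAcyclic (hδ : δ.IsCovering) (h : IsPEP δ R) : (coverGraph R).IsAcyclic := by
  have key {v p : Fin n} (hp : coverRel R v p) :
      ¬ ((coverGraph R).deleteEdges {s(v, p)}).Reachable p v := fun k =>
    (h.subtree_subset_upSide hδ hp k).1.1 rfl
  rw [SimpleGraph.isAcyclic_iff_forall_adj_isBridge]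
  rintro v p ⟨-, hvp | hpv⟩
  · rw [SimpleGraph.isBridge_iff]
    exact fun k => key hvp k.symm
  · rw [SimpleGraph.isBridge_iff, Sym2.eq_swap]
    exact key hpv

theorem IsPEP.isPermutree (hδ : δ.IsCovering) (h : IsPEP δ R) : IsPermutree δ (coverRel R) where
  asymm i j hij hji := hij.1 (h.antisymm hij.2.1 hji.2.1)
  connected := h.preconnected
  acyclic := h.isAcyclic hδ
  parents := h.slotCondition hδ
  children v := by
    have := h.op.slotCondition hδ.op v
    simp only [coverGraph_op, coverRel_op] at this
    exact this

theorem IsPEP.mem_PEP (hδ : δ.IsCovering) (h : IsPEP δ R) : R ∈ PEP δ :=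
  ⟨coverRel R, h.isPermutree hδ, (reflTransGen_coverRel h.mem_IPos).symm⟩

end

/-! ### Subtrees of a tree -/

section
variable {G : SimpleGraph (Fin n)} {u v w p q : Fin n}

theorem self_mem_subtree : q ∈ subtree G v q := SimpleGraph.Reachable.rfl

theorem subtree_disjoint (hG : G.IsAcyclic) (h : G.Adj v q) (hw : w ∈ subtree G v q) :
    w ∉ subtree G q v := by
  intro hw'
  have := SimpleGraph.isAcyclic_iff_forall_adj_isBridge.1 hG h
  rw [SimpleGraph.isBridge_iff] at this
  refine this (SimpleGraph.Reachable.trans ?_ (SimpleGraph.Reachable.symm hw))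
  have hw'' : (G.deleteEdges {s(q, v)}).Reachable v w := hw'
  rwa [Sym2.eq_swap] at hw''

theorem notMem_subtree (hG : G.IsAcyclic) (h : G.Adj v q) : v ∉ subtree G v q := fun hv =>
  subtree_disjoint hG h hv self_mem_subtree

theorem mem_subtree_of_adj (hG : G.IsAcyclic) (h : G.Adj v q) (hu : u ∈ subtree G v q)
    (huw : G.Adj u w) (hw : w ≠ v) : w ∈ subtree G v q := by
  have huv : u ≠ v := fun e => notMem_subtree hG h (e ▸ hu)
  refine SimpleGraph.Reachable.trans hu (SimpleGraph.Adj.reachable ?_)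
  rw [SimpleGraph.deleteEdges_adj]
  refine ⟨huw, fun k => ?_⟩
  rcases Sym2.eq_iff.1 k with k | k
  · exact huv k.1
  · exact hw k.2

theorem eq_of_mem_subtree_of_adj (hG : G.IsAcyclic) (h : G.Adj v q) (hu : u ∈ subtree G v q)
    (huv : G.Adj u v) : u = q := by
  by_contra hne
  refine notMem_subtree hG h (SimpleGraph.Reachable.trans hu (SimpleGraph.Adj.reachable ?_))
  rw [SimpleGraph.deleteEdges_adj]
  refine ⟨huv, fun k => ?_⟩
  rcases Sym2.eq_iff.1 k with k | k
  · exact huv.ne k.1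
  · exact hne k.1

theorem exists_mem_subtree (hG : G.IsAcyclic) (hc : G.Preconnected) (hw : w ≠ v) :
    ∃ q, G.Adj v q ∧ w ∈ subtree G v q := by
  have := (SimpleGraph.reachable_iff_reflTransGen _ _).1 (hc v w)
  induction this with
  | refl => exact absurd rfl hw
  | @tail x y _ hxy ih =>
    by_cases hx : x = v
    · exact ⟨y, hx ▸ hxy, self_mem_subtree⟩
    · obtain ⟨q, hq, h⟩ := ih hx
      exact ⟨q, hq, mem_subtree_of_adj hG hq h hxy hw⟩

theorem eq_of_mem_subtree (hG : G.IsAcyclic) (hp : G.Adj v p) (hq : G.Adj v q)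
    (hwp : w ∈ subtree G v p) (hwq : w ∈ subtree G v q) : p = q := by
  by_contra hne
  have : subtree G v q ⊆ {x | x ∈ subtree G v q ∧ x ∉ subtree G v p} := by
    apply subtree_subset
    · exact ⟨self_mem_subtree, fun h => hne (eq_of_mem_subtree_of_adj hG hp h hq.symm).symm⟩
    · rintro x ⟨hx, hx'⟩ y hxy hxyq
      have hyv : y ≠ v := by
        rintro rfl
        exact hxyq (eq_of_mem_subtree_of_adj hG hq hx hxy ▸ Sym2.eq_swap)
      refine ⟨mem_subtree_of_adj hG hq hx hxy hyv, fun hy => hx' ?_⟩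
      refine mem_subtree_of_adj hG hp hy hxy.symm ?_
      rintro rfl
      exact notMem_subtree hG hq hx
  exact (this hwq).2 hwp

theorem subtree_subset_subtree (hG : G.IsAcyclic) (hp : G.Adj v p) (hq : G.Adj v q)
    (hne : p ≠ q) : subtree G v p ⊆ subtree G q v := by
  have : subtree G v p ⊆ {x | x ∈ subtree G v p ∧ x ∈ subtree G q v} := by
    apply subtree_subset
    · exact ⟨self_mem_subtree, mem_subtree_of_adj hG hq.symm self_mem_subtree hp hne⟩
    · rintro x ⟨hx, hx'⟩ y hxy hxyp
      have hyv : y ≠ v := by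
        rintro rfl
        exact hxyp (eq_of_mem_subtree_of_adj hG hp hx hxy ▸ Sym2.eq_swap)
      have hy := mem_subtree_of_adj hG hp hx hxy hyv
      refine ⟨hy, mem_subtree_of_adj hG hq.symm hx' hxy ?_⟩
      rintro rfl
      exact hne (eq_of_mem_subtree hG hp hq hy self_mem_subtree)
  exact fun w hw => (this hw).2

/-- The decreasing measure for inductions that walk along the tree without turning back. -/
theorem ncard_subtree_lt (hG : G.IsAcyclic) (hp : G.Adj v p) (hq : G.Adj v q)
    (hne : p ≠ q) : (subtree G v p).ncard < (subtree G q v).ncard :=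
  Set.ncard_lt_ncard ⟨subtree_subset_subtree hG hp hq hne,
    fun h => notMem_subtree hG hp (h self_mem_subtree)⟩

end

/-! ### The poset of a permutree -/

section
variable {δ : PermutreeOrientation n} {up : Fin n → Fin n → Prop}

theorem fromRel_swap (up : Fin n → Fin n → Prop) :
    SimpleGraph.fromRel (fun i j => up j i) = SimpleGraph.fromRel up := by
  ext a b
  simp only [SimpleGraph.fromRel_adj, or_comm]

theorem permutreeRel_swap (up : Fin n → Fin n → Prop) :
    permutreeRel (fun i j => up j i) = (permutreeRel up).op := by
  funext a b
  exact propext Relation.reflTransGen_swap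

theorem IsPermutree.op (h : IsPermutree δ up) : IsPermutree δ.op (fun i j => up j i) where
  asymm i j hij hji := h.asymm i j hji hij
  connected := by rw [fromRel_swap]; exact h.connected
  acyclic := by rw [fromRel_swap]; exact h.acyclic
  parents v := by rw [fromRel_swap]; exact h.children v
  children v := by rw [fromRel_swap]; exact h.parents v

theorem IsPermutree.adj (h : IsPermutree δ up) {i j : Fin n} (hij : up i j) :
    (SimpleGraph.fromRel up).Adj i j := by
  refine ⟨?_, .inl hij⟩
  rintro rfl
  exact h.asymm i i hij hij

theorem IsPermutree.mem_subtree (h : IsPermutree δ up) {v q w : Fin n} (hvq : up v q)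
    (hqw : permutreeRel up q w) : w ∈ subtree (SimpleGraph.fromRel up) v q := by
  induction hqw with
  | refl => exact self_mem_subtree
  | @tail x y _ hxy ih =>
    refine mem_subtree_of_adj h.acyclic (h.adj hvq) ih (h.adj hxy) ?_
    rintro rfl
    have := eq_of_mem_subtree_of_adj h.acyclic (h.adj hvq) ih (h.adj hxy)
    exact h.asymm _ _ hvq (this ▸ hxy)

theorem IsPermutree.mem_subtree' (h : IsPermutree δ up) {v q w : Fin n} (hqv : up q v)
    (hwq : permutreeRel up w q) : w ∈ subtree (SimpleGraph.fromRel up) v q := by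
  have := h.op.mem_subtree (v := v) (q := q) (w := w) hqv
    (by rw [permutreeRel_swap]; exact hwq)
  rwa [fromRel_swap] at this

theorem IsPermutree.rel_of_crossing (h : IsPermutree δ up) {a b c p : Fin n}
    (hp : (SimpleGraph.fromRel up).Adj b p) (hac : permutreeRel up a c)
    (ha : a ∈ subtree (SimpleGraph.fromRel up) b p)
    (hc : c ∉ subtree (SimpleGraph.fromRel up) b p) :
    permutreeRel up a b ∧ permutreeRel up b c := by
  induction hac with
  | refl => exact absurd ha hc
  | @tail x y hax hxy ih =>
    by_cases hx : x ∈ subtree (SimpleGraph.fromRel up) b p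
    · have hyb : y = b := by
        by_contra hyb
        exact hc (mem_subtree_of_adj h.acyclic hp hx (h.adj hxy) hyb)
      subst hyb
      exact ⟨hax.tail hxy, .refl⟩
    · exact ⟨(ih hx).1, (ih hx).2.tail hxy⟩

theorem IsPermutree.permutreeRel_mem_IPos (h : IsPermutree δ up) : permutreeRel up ∈ IPos n := by
  refine ⟨fun u => .refl, fun u v w => .trans, fun u v huv hvu => ?_⟩
  rcases Relation.ReflTransGen.cases_head huv with rfl | ⟨x, hux, hxv⟩
  · rfl
  · exact absurd (h.mem_subtree hux (hxv.trans hvu)) (notMem_subtree h.acyclic (h.adj hux))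

/-- A vertex has at most one child on each side, so two children, with their whole subtrees, are on
opposite sides. -/
theorem IsPermutree.btw_of_children (h : IsPermutree δ up) {x y q u w : Fin n} (hx : up x q)
    (hy : up y q) (hxy : x ≠ y) (hu : u ∈ subtree (SimpleGraph.fromRel up) q x)
    (hw : w ∈ subtree (SimpleGraph.fromRel up) q y) : q ∈ δ.neg ∧ Btw u q w := by
  obtain ⟨h1, h2⟩ := h.children q
  have hq : q ∈ δ.neg := by
    by_contra hq
    exact hxy (h1 hq x hx y hy)
  obtain ⟨h3, h4, h5⟩ := h2 hq
  refine ⟨hq, ?_⟩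
  have hxq := (h.adj hx).ne
  have hyq := (h.adj hy).ne
  rcases lt_or_gt_of_ne hxq with k | k <;> rcases lt_or_gt_of_ne hyq with l | l
  · exact absurd (h3 x hx y hy (by simp only [k, l])) hxy
  · exact .inl ⟨h4 x hx k u hu, h5 y hy l w hw⟩
  · exact .inr ⟨h4 y hy l w hw, h5 x hx k u hu⟩
  · exact absurd (h3 x hx y hy (by simp only [not_lt.2 k.le, not_lt.2 l.le])) hxy

/-- Follow the tree path from `a` towards `c` as long as it goes up. At the first descent, at `q`,
the labels `a` and `c` belong to different children of `q`, so `q ∈ δ⁻` lies between them. -/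
theorem IsPermutree.exists_of_mem_subtree (h : IsPermutree δ up) {a c x q : Fin n}
    (hax : permutreeRel up a x) (hxq : up x q)
    (hc : c ∈ subtree (SimpleGraph.fromRel up) x q) :
    permutreeRel up a c ∨ ∃ b, Btw a b c ∧ b ∈ δ.neg ∧ permutreeRel up a b := by
  induction hm : (subtree (SimpleGraph.fromRel up) x q).ncard using Nat.strong_induction_on
    generalizing x q with
  | _ m ih =>
    have haq : permutreeRel up a q := hax.tail hxq
    by_cases hcq : c = q
    · exact .inl (hcq ▸ haq)
    obtain ⟨r, hqr, hcr⟩ := exists_mem_subtree h.acyclic h.connected hcq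
    have hrx : r ≠ x := by
      rintro rfl
      exact subtree_disjoint h.acyclic (h.adj hxq) hc hcr
    rcases hqr.2 with k | k
    · refine ih _ ?_ haq k hcr rfl
      rw [← hm]
      exact ncard_subtree_lt h.acyclic hqr (h.adj hxq).symm hrx
    · obtain ⟨h1, h2⟩ := h.btw_of_children hxq k hrx.symm (h.mem_subtree' hxq hax) hcr
      exact .inr ⟨q, h2, h1, haq⟩

theorem IsPermutree.link (h : IsPermutree δ up) {a c : Fin n} (hac : a ≠ c) :
    permutreeRel up a c ∨ permutreeRel up c a ∨ ∃ b, Btw a b c ∧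
      (b ∈ δ.neg ∧ permutreeRel up a b ∨ b ∈ δ.pos ∧ permutreeRel up b a) := by
  obtain ⟨q, haq, hc⟩ := exists_mem_subtree h.acyclic h.connected hac.symm
  rcases haq.2 with k | k
  · rcases h.exists_of_mem_subtree .refl k hc with l | ⟨b, hb, l⟩
    · exact .inl l
    · exact .inr (.inr ⟨b, hb, .inl l⟩)
  · have := h.op.exists_of_mem_subtree (a := a) (x := a) (q := q) (c := c) .refl k
      (by rwa [fromRel_swap])
    rw [permutreeRel_swap] at this
    rcases this with l | ⟨b, hb, l⟩
    · exact .inr (.inl l)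
    · exact .inr (.inr ⟨b, hb, .inr l⟩)

/-- Walk from `b` towards `a` and `c`. A descent would put both on the same side of `b`, so the walk
goes up. It stops at `a`, at `c`, or where the two directions separate; there the directed path from
`a` to `c` must pass. -/
theorem IsPermutree.rel_of_mem_subtree (h : IsPermutree δ up) {a b c x q : Fin n}
    (hb : b ∈ δ.neg) (habc : Btw a b c) (hac : permutreeRel up a c) (hbx : permutreeRel up b x)
    (hxq : (SimpleGraph.fromRel up).Adj x q)
    (ha : a ∈ subtree (SimpleGraph.fromRel up) x q)
    (hc : c ∈ subtree (SimpleGraph.fromRel up) x q)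
    (hbq : b ∈ subtree (SimpleGraph.fromRel up) q x) : permutreeRel up b c := by
  induction hm : (subtree (SimpleGraph.fromRel up) x q).ncard using Nat.strong_induction_on
    generalizing x q with
  | _ m ih =>
    have hup : up x q := by
      refine hxq.2.resolve_right fun hqx => ?_
      rcases Relation.ReflTransGen.cases_tail hbx with rfl | ⟨y, hby, hyx⟩
      · obtain ⟨-, h2⟩ := h.children x
        obtain ⟨-, h4, h5⟩ := h2 hb
        rcases lt_or_gt_of_ne hxq.ne with k | k
        · have h6 := h5 q hqx k a ha
          have h7 := h5 q hqx k c hc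
          rcases habc with l | l <;> order
        · have h6 := h4 q hqx k a ha
          have h7 := h4 q hqx k c hc
          rcases habc with l | l <;> order
      · have hb' := h.mem_subtree' hyx hby
        have hyq : y ≠ q := by
          rintro rfl
          exact subtree_disjoint h.acyclic hxq hb' hbq
        have h1 := (h.btw_of_children hyx hqx hyq hb' ha).2
        have h2 := (h.btw_of_children hyx hqx hyq hb' hc).2
        simp only [Btw] at h1 h2 habc
        grind
    have hbq' : permutreeRel up b q := hbx.tail hup
    by_cases hcq : c = q
    · exact hcq ▸ hbq'
    by_cases haq : a = q
    · exact hbq'.trans (haq ▸ hac)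
    obtain ⟨r, hqr, har⟩ := exists_mem_subtree h.acyclic h.connected haq
    by_cases hcr : c ∈ subtree (SimpleGraph.fromRel up) q r
    swap
    · exact hbq'.trans (h.rel_of_crossing hqr hac har hcr).2
    have hrx : r ≠ x := by
      rintro rfl
      exact subtree_disjoint h.acyclic hxq hc hcr
    refine ih _ ?_ hbq' hqr har hcr
      (subtree_subset_subtree h.acyclic hxq.symm hqr hrx.symm hbq) rfl
    rw [← hm]
    exact ncard_subtree_lt h.acyclic hqr hxq.symm hrx

theorem IsPermutree.neg (h : IsPermutree δ up) {a b c : Fin n} (hb : b ∈ δ.neg)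
    (habc : Btw a b c) (hac : permutreeRel up a c) : permutreeRel up b c := by
  have hab : a ≠ b := by rintro rfl; rcases habc with k | k <;> order
  obtain ⟨q, hq, ha⟩ := exists_mem_subtree h.acyclic h.connected hab
  by_cases hc : c ∈ subtree (SimpleGraph.fromRel up) b q
  · exact h.rel_of_mem_subtree hb habc hac .refl hq ha hc self_mem_subtree
  · exact (h.rel_of_crossing hq hac ha hc).2

theorem IsPermutree.isPEP (h : IsPermutree δ up) : IsPEP δ (permutreeRel up) where
  mem_IPos := h.permutreeRel_mem_IPos
  neg := h.neg
  pos {a b c} hb habc hac := by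
    have := h.op.neg (a := c) (b := b) (c := a) hb habc.symm
      (by rw [permutreeRel_swap]; exact hac)
    rwa [permutreeRel_swap] at this
  link := h.link

/-- Permutree element posets are characterized by the combinatorial conditions. -/
theorem mem_PEP_iff (hδ : δ.IsCovering) {R : IRel n} : R ∈ PEP δ ↔ IsPEP δ R := by
  refine ⟨?_, IsPEP.mem_PEP hδ⟩
  rintro ⟨up, h, rfl⟩
  exact h.isPEP

/-- Permutree element posets of a covering orientation form a sublattice. -/
theorem inducesSublattice_PEP (hδ : δ.IsCovering) : InducesSublattice (PEP δ) := by
  refine ⟨fun R hR => ((mem_PEP_iff hδ).1 hR).mem_IPos, fun R hR S hS => ?_⟩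
  rw [mem_PEP_iff hδ] at hR hS ⊢
  rw [mem_PEP_iff hδ]
  exact ⟨hR.meetT hδ hS, hR.joinT hδ hS⟩

/-- An order embedding with image `PEP δ` is a lattice embedding. -/
theorem isLatticeEmbedding_of_range (hδ : δ.IsCovering) {P : Type} {le : P → P → Prop}
    {f : P → IRel n} (hf : Function.Injective f) (hle : ∀ x y, le x y ↔ f x ≤ f y)
    (hrange : Set.range f = PEP δ) : IsLatticeEmbedding le f := by
  have hmem (x : P) : f x ∈ PEP δ := hrange ▸ Set.mem_range_self x
  obtain ⟨hsub, hcl⟩ := inducesSublattice_PEP hδ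
  refine ⟨fun x => hsub (hmem x), hf, hle, fun x y => ?_, fun x y => ?_⟩
  · obtain ⟨m, hm⟩ : meetT (f x) (f y) ∈ Set.range f :=
      hrange ▸ (hcl _ (hmem x) _ (hmem y)).1
    have key {T : IRel n} (hT : T ∈ IPos n) :=
      le_meetT_iff (hsub (hmem x)) (hsub (hmem y)) hT
    have hm' := (key (hsub (hmem m))).1 hm.le
    refine ⟨m, ⟨(hle _ _).2 hm'.1, (hle _ _).2 hm'.2, fun z hx hy => ?_⟩, hm⟩
    rw [hle, hm, key (hsub (hmem z))]
    exact ⟨(hle _ _).1 hx, (hle _ _).1 hy⟩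
  · obtain ⟨m, hm⟩ : joinT (f x) (f y) ∈ Set.range f :=
      hrange ▸ (hcl _ (hmem x) _ (hmem y)).2
    have key {T : IRel n} (hT : T ∈ IPos n) :=
      joinT_le_iff (hsub (hmem x)) (hsub (hmem y)) hT
    have hm' := (key (hsub (hmem m))).1 hm.ge
    refine ⟨m, ⟨(hle _ _).2 hm'.1, (hle _ _).2 hm'.2, fun z hx hy => ?_⟩, hm⟩
    rw [hle, hm, key (hsub (hmem z))]
    exact ⟨(hle _ _).1 hx, (hle _ _).1 hy⟩

end

/-! ### The permutree element poset of a permutation -/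

/-- The permutree element poset of which the permutation `σ` is a linear extension. -/
def linRel (δ : PermutreeOrientation n) (σ : Equiv.Perm (Fin n)) : IRel n := fun x y =>
  ∀ b b', (x ≤ b ∧ b < b' ∧ b' ≤ y) ∨ (y ≤ b' ∧ b' < b ∧ b ≤ x) →
    (b = x ∨ b ∈ δ.neg) → (b' = y ∨ b' ∈ δ.pos) → σ.symm b < σ.symm b'

/-- The permutation `σ` is a linear extension of `R`. -/
def IsLinearExtension (R : IRel n) (σ : Equiv.Perm (Fin n)) : Prop :=
  ∀ x y, R x y → σ.symm x ≤ σ.symm y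

section
variable {δ : PermutreeOrientation n} {R : IRel n} {σ τ : Equiv.Perm (Fin n)}

theorem IsLinearExtension.lt (h : IsLinearExtension R σ) {x y : Fin n} (hxy : R x y)
    (hne : x ≠ y) : σ.symm x < σ.symm y :=
  lt_of_le_of_ne (h x y hxy) fun e => hne (σ.symm.injective e)

theorem isLinearExtension_linRel : IsLinearExtension (linRel δ σ) σ := by
  intro x y h
  rcases lt_trichotomy x y with k | rfl | k
  · exact (h x y (.inl ⟨le_rfl, k, le_rfl⟩) (.inl rfl) (.inl rfl)).le
  · exact le_rfl
  · exact (h x y (.inr ⟨le_rfl, k, le_rfl⟩) (.inl rfl) (.inl rfl)).le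

theorem linRel_neg {a b c : Fin n} (hb : b ∈ δ.neg) (habc : Btw a b c) (h : linRel δ σ a c) :
    linRel δ σ b c := by
  intro d d' hd hdn hdp
  refine h d d' ?_ (.inr (hdn.elim (fun e => e ▸ hb) id)) hdp
  simp only [Btw] at habc
  grind

theorem linRel_pos {a b c : Fin n} (hb : b ∈ δ.pos) (habc : Btw a b c) (h : linRel δ σ a c) :
    linRel δ σ a b := by
  intro d d' hd hdn hdp
  refine h d d' ?_ hdn (.inr (hdp.elim (fun e => e ▸ hb) id))
  simp only [Btw] at habc
  grind

theorem linRel_antisymm {u v : Fin n} (h : linRel δ σ u v) (k : linRel δ σ v u) : u = v :=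
  σ.symm.injective (le_antisymm (isLinearExtension_linRel u v h) (isLinearExtension_linRel v u k))

/-- A tested pair `b`, `b'` either stays on one side of `v`, or straddles it and is compared through
the position of `v`. -/
theorem linRel_trans_of_btw {u v w : Fin n} (hb : Btw u v w) (h : linRel δ σ u v)
    (k : linRel δ σ v w) : linRel δ σ u w := by
  intro b b' hbb hn hp
  rcases hb with ⟨huv, hvw⟩ | ⟨hwv, hvu⟩
  · obtain ⟨hub, hbb, hbw⟩ := hbb.resolve_right fun e => by order
    rcases le_or_gt b' v with hv | hv
    · exact h b b' (.inl ⟨hub, hbb, hv⟩) hn (.inr (hp.resolve_left (hv.trans_lt hvw).ne))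
    rcases le_or_gt v b with hv' | hv'
    · exact k b b' (.inl ⟨hv', hbb, hbw⟩) (.inr (hn.resolve_left (huv.trans_le hv').ne')) hp
    exact (h b v (.inl ⟨hub, hv', le_rfl⟩) hn (.inl rfl)).trans
      (k v b' (.inl ⟨le_rfl, hv, hbw⟩) (.inl rfl) hp)
  · obtain ⟨hwb, hbb, hbu⟩ := hbb.resolve_left fun e => by order
    rcases le_or_gt v b' with hv | hv
    · exact h b b' (.inr ⟨hv, hbb, hbu⟩) hn (.inr (hp.resolve_left (hwv.trans_le hv).ne'))
    rcases le_or_gt b v with hv' | hv'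
    · exact k b b' (.inr ⟨hwb, hbb, hv'⟩) (.inr (hn.resolve_left (hv'.trans_lt hvu).ne)) hp
    exact (h b v (.inr ⟨le_rfl, hv', hbu⟩) hn (.inl rfl)).trans
      (k v b' (.inr ⟨hwb, hv, le_rfl⟩) (.inl rfl) hp)

theorem linRel_trans (hδ : δ.IsCovering) {u v w : Fin n} (h : linRel δ σ u v)
    (k : linRel δ σ v w) : linRel δ σ u w := by
  rcases eq_or_ne u v with rfl | huv
  · exact k
  rcases eq_or_ne v w with rfl | hvw
  · exact h
  rcases eq_or_ne u w with rfl | huw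
  · exact absurd (linRel_antisymm h k) huv
  rcases btw_or_btw_or_btw huv hvw huw with l | l | l
  · exact linRel_trans_of_btw l h k
  · rcases hδ.of_btw l with hp | hn
    · exact absurd (linRel_antisymm h (linRel_pos hp l k)) huv
    · exact linRel_neg hn l k
  · rcases hδ.of_btw l with hp | hn
    · exact linRel_pos hp l.symm h
    · exact absurd (linRel_antisymm k (linRel_neg hn l.symm h)) hvw

/-- Scan upwards from `a` for the first label of `δ⁺` standing before `a` or of `δ⁻` standing after
`a`; if there is none before `c`, use `c`. All labels passed over are on the harmless side of `a` in
the word, so `a` and the label found are related in the order given by `σ`. -/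
theorem linRel_link {a c : Fin n} (hac : a < c) : linRel δ σ a c ∨ linRel δ σ c a ∨
    ∃ b, a < b ∧ b < c ∧ (b ∈ δ.neg ∧ linRel δ σ a b ∨ b ∈ δ.pos ∧ linRel δ σ b a) := by
  have key (e : Fin n) (hae : a < e)
      (hn : ∀ b, a < b → b < e → b ∈ δ.neg → σ.symm b < σ.symm a)
      (hp : ∀ b, a < b → b < e → b ∈ δ.pos → σ.symm a < σ.symm b) :
      (σ.symm a < σ.symm e → linRel δ σ a e) ∧ (σ.symm e < σ.symm a → linRel δ σ e a) := by
    constructor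
    · intro hlt b b' hbb hb hb'
      have h1 : σ.symm b ≤ σ.symm a := by
        rcases hb with rfl | hb
        · exact le_rfl
        · rcases eq_or_ne b a with rfl | hne
          · exact le_rfl
          · exact (hn b (by grind) (by grind) hb).le
      have h2 : σ.symm a < σ.symm b' := by
        rcases hb' with rfl | hb'
        · exact hlt
        · rcases eq_or_ne b' e with rfl | hne
          · exact hlt
          · exact hp b' (by grind) (by grind) hb'
      exact h1.trans_lt h2
    · intro hlt b b' hbb hb hb'
      have h1 : σ.symm b < σ.symm a := by
        rcases hb with rfl | hb
        · exact hlt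
        · rcases eq_or_ne b e with rfl | hne
          · exact hlt
          · exact hn b (by grind) (by grind) hb
      have h2 : σ.symm a ≤ σ.symm b' := by
        rcases hb' with rfl | hb'
        · exact le_rfl
        · rcases eq_or_ne b' a with rfl | hne
          · exact le_rfl
          · exact (hp b' (by grind) (by grind) hb').le
      exact h1.trans_le h2
  let W : Set (Fin n) := {e | a < e ∧ e < c ∧
    (e ∈ δ.pos ∧ σ.symm e < σ.symm a ∨ e ∈ δ.neg ∧ σ.symm a < σ.symm e)}
  have hne {b : Fin n} (hb : a < b) : σ.symm b < σ.symm a ∨ σ.symm a < σ.symm b :=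
    lt_or_gt_of_ne fun e => hb.ne' (σ.symm.injective e)
  by_cases hW : W.Nonempty
  · obtain ⟨e, he, hmin⟩ := (Set.toFinite W).exists_minimal hW
    have hmin' (b : Fin n) (hab : a < b) (hbe : b < e) : b ∉ W := fun hb =>
      absurd (hmin hb hbe.le) (not_le.2 hbe)
    obtain ⟨hae, hec, he⟩ := he
    have := key e hae
      (fun b hab hbe hb => (hne hab).resolve_right fun k =>
        hmin' b hab hbe ⟨hab, hbe.trans hec, .inr ⟨hb, k⟩⟩)
      (fun b hab hbe hb => (hne hab).resolve_left fun k =>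
        hmin' b hab hbe ⟨hab, hbe.trans hec, .inl ⟨hb, k⟩⟩)
    refine .inr (.inr ⟨e, hae, hec, ?_⟩)
    rcases he with he | he
    · exact .inr ⟨he.1, this.2 he.2⟩
    · exact .inl ⟨he.1, this.1 he.2⟩
  · have hW' (b : Fin n) : b ∉ W := fun hb => hW ⟨b, hb⟩
    have := key c hac
      (fun b hab hbe hb => (hne hab).resolve_right fun k => hW' b ⟨hab, hbe, .inr ⟨hb, k⟩⟩)
      (fun b hab hbe hb => (hne hab).resolve_left fun k => hW' b ⟨hab, hbe, .inl ⟨hb, k⟩⟩)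
    rcases hne hac with k | k
    · exact .inr (.inl (this.2 k))
    · exact .inl (this.1 k)

theorem isPEP_linRel (hδ : δ.IsCovering) : IsPEP δ (linRel δ σ) :=
  .of_link_lt
    ⟨fun u b b' h => by grind, fun _ _ _ => linRel_trans hδ, fun _ _ => linRel_antisymm⟩
    linRel_neg linRel_pos linRel_link

/-- The conditions `neg` and `pos` turn `a → c` into every relation tested by `linRel`. Conversely,
`link` rebuilds `a → c` by induction on the distance, as the opposite alternatives disagree with
`σ`. -/
theorem IsPEP.eq_linRel (h : IsPEP δ R) (hσ : IsLinearExtension R σ) : R = linRel δ σ := by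
  have key (m : ℕ) : ∀ a c : Fin n, (a.val - c.val) + (c.val - a.val) = m → linRel δ σ a c →
      R a c := by
    induction m using Nat.strong_induction_on with
    | _ m ih =>
      intro a c hm hac
      rcases eq_or_ne a c with rfl | hne
      · exact h.refl a
      rcases h.link hne with k | k | ⟨e, he, k | k⟩
      · exact k
      · exact absurd (isLinearExtension_linRel.lt hac hne) (not_lt.2 (hσ _ _ k))
      · refine h.trans k.2 (ih _ ?_ e c rfl (linRel_neg k.1 he hac))
        simp only [Btw, Fin.lt_def] at he
        omega
      · have hea : e ≠ a := by
          rintro rfl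
          rcases he with l | l <;> order
        exact absurd (hσ.lt k.2 hea)
          (not_lt.2 (isLinearExtension_linRel _ _ (linRel_pos k.1 he hac)))
  funext a c
  refine propext ⟨fun hac b b' hbb hb hb' => ?_, key _ a c rfl⟩
  have h1 : R b c := by
    rcases eq_or_ne b a with rfl | hne
    · exact hac
    · refine h.neg (hb.resolve_left hne) ?_ hac
      simp only [Btw]
      grind
  have h2 : R b b' := by
    rcases eq_or_ne b' c with rfl | hne
    · exact h1
    · refine h.pos (hb'.resolve_left hne) ?_ h1
      simp only [Btw]
      grind
  refine hσ.lt h2 ?_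
  rintro rfl
  rcases hbb with k | k <;> order

/-! ### The Cambrian congruence -/

theorem swap_lt_swap {k l i j : Fin n} (hl : l.val = k.val + 1) (hij : i < j)
    (hne : ¬ (i = k ∧ j = l)) : Equiv.swap k l i < Equiv.swap k l j := by
  simp only [Equiv.swap_apply_def, Fin.ext_iff, Fin.lt_def] at *
  split_ifs <;> omega

theorem mul_swap_symm_apply (σ : Equiv.Perm (Fin n)) (k l x : Fin n) :
    (σ * Equiv.swap k l).symm x = Equiv.swap k l (σ.symm x) := by
  rw [← Equiv.Perm.inv_def, mul_inv_rev, Equiv.swap_inv]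
  rfl

/-- By uniqueness it suffices that `τ` extends `linRel δ σ`. Only the exchanged pair could fail, and
the position of the witness `b` shows that it is not related. -/
theorem linRel_eq_of_cambrianMove (hδ : δ.IsCovering) (h : CambrianMove δ σ τ) :
    linRel δ σ = linRel δ τ := by
  refine (isPEP_linRel hδ).eq_linRel fun x y hxy => ?_
  obtain ⟨k, l, hl, rfl, b, h1, h2, hb⟩ := h
  rw [mul_swap_symm_apply, mul_swap_symm_apply]
  rcases eq_or_ne x y with rfl | hne
  · exact le_rfl
  refine (swap_lt_swap hl (isLinearExtension_linRel.lt hxy hne) ?_).le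
  rintro ⟨hx, hy⟩
  obtain rfl := (Equiv.symm_apply_eq σ).1 hx
  obtain rfl := (Equiv.symm_apply_eq σ).1 hy
  rcases hb with ⟨hn, hb⟩ | ⟨hp, hb⟩
  · have := isLinearExtension_linRel _ _ (linRel_neg hn (.inl ⟨h1, h2⟩) hxy)
    rw [Equiv.symm_apply_apply] at this
    order
  · have := isLinearExtension_linRel _ _ (linRel_pos hp (.inl ⟨h1, h2⟩) hxy)
    rw [Equiv.symm_apply_apply] at this
    order

/-- Otherwise `τ⁻¹σ` would be increasing, hence the identity. -/
theorem exists_descent (h : σ ≠ τ) : ∃ k l : Fin n, l.val = k.val + 1 ∧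
    τ.symm (σ l) < τ.symm (σ k) := by
  by_contra hcon
  push Not at hcon
  have hmono : StrictMono fun i => τ.symm (σ i) := by
    have step (m : ℕ) : ∀ i j : Fin n, i.val + (m + 1) = j.val → τ.symm (σ i) < τ.symm (σ j) := by
      induction m with
      | zero =>
        intro i j hij
        refine lt_of_le_of_ne (hcon i j hij.symm) fun e => ?_
        have := σ.injective (τ.symm.injective e)
        omega
      | succ m ih =>
        intro i j hij
        have hlt : i.val + (m + 1) < n := by omega
        refine (ih i ⟨i.val + (m + 1), hlt⟩ rfl).trans_le (hcon _ _ ?_)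
        simp only
        omega
    intro i j hij
    rw [Fin.lt_def] at hij
    exact step (j.val - i.val - 1) i j (by omega)
  have hid : (fun i => τ.symm (σ i)) = id := by
    refine (hmono.range_inj strictMono_id).1 ?_
    exact (σ.trans τ.symm).surjective.range_eq.trans Set.range_id.symm
  refine h (Equiv.ext fun i => ?_)
  have := congrFun hid i
  exact (Equiv.symm_apply_eq τ).1 this

theorem IsPEP.cambrianMove_or (h : IsPEP δ R) (hσ : IsLinearExtension R σ) {k l : Fin n}
    (hl : l.val = k.val + 1) (h1 : ¬ R (σ k) (σ l)) (h2 : ¬ R (σ l) (σ k)) :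
    CambrianMove δ σ (σ * Equiv.swap k l) ∨ CambrianMove δ (σ * Equiv.swap k l) σ := by
  have hkl : k ≠ l := by
    rintro rfl
    omega
  obtain ⟨b, hb, hb'⟩ : ∃ b, Btw (σ k) b (σ l) ∧
      (b ∈ δ.neg ∧ l < σ.symm b ∨ b ∈ δ.pos ∧ σ.symm b < k) := by
    rcases h.link (σ.injective.ne hkl) with m | m | ⟨b, hb, m⟩
    · exact absurd m h1
    · exact absurd m h2
    refine ⟨b, hb, m.imp (fun m => ⟨m.1, ?_⟩) fun m => ⟨m.1, ?_⟩⟩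
    · have h3 : b ≠ σ k := by rintro rfl; rcases hb with k | k <;> order
      have h4 : σ.symm b ≠ l := by
        intro e
        obtain rfl := (Equiv.symm_apply_eq σ).1 e
        rcases hb with k | k <;> order
      have := hσ.lt m.2 h3.symm
      rw [Equiv.symm_apply_apply] at this
      rw [ne_eq, Fin.ext_iff] at h4
      rw [Fin.lt_def] at this ⊢
      omega
    · have h3 : b ≠ σ k := by rintro rfl; rcases hb with k | k <;> order
      have := hσ.lt m.2 h3
      rwa [Equiv.symm_apply_apply] at this
  rcases hb with hb | hb
  · exact .inl ⟨k, l, hl, rfl, b, hb.1, hb.2, hb'⟩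
  -- A move exchanges an ascent; here `σ` has a descent, so the move starts from the exchanged word.
  · refine .inr ⟨k, l, hl, ?_, b, ?_, ?_, ?_⟩
    · rw [mul_assoc, Equiv.swap_mul_self, mul_one]
    · rw [Equiv.Perm.mul_apply, Equiv.swap_apply_left]
      exact hb.1
    · rw [Equiv.Perm.mul_apply, Equiv.swap_apply_right]
      exact hb.2
    · rw [mul_swap_symm_apply, Equiv.swap_apply_of_ne_of_ne]
      · exact hb'
      · intro e
        rw [Fin.lt_def, Fin.lt_def, e] at hb'
        omega
      · intro e
        rw [Fin.lt_def, Fin.lt_def, e] at hb'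
        omega

/-- All linear extensions of a permutree element poset are congruent. -/
theorem IsPEP.mk_eq_mk (h : IsPEP δ R) (hσ : IsLinearExtension R σ)
    (hτ : IsLinearExtension R τ) : Quot.mk (CambrianMove δ) σ = Quot.mk (CambrianMove δ) τ := by
  -- The measure counts the pairs on which the two words disagree; exchanging adjacent letters that
  -- `τ` has in the other order lowers it.
  induction hm : {p : Fin n × Fin n | σ.symm p.1 < σ.symm p.2 ∧ τ.symm p.2 < τ.symm p.1}.ncard
    using Nat.strong_induction_on generalizing σ with
  | _ m ih =>
    by_cases hne : σ = τ
    · rw [hne]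
    obtain ⟨k, l, hl, hkl⟩ := exists_descent hne
    have hlt : k < l := by
      rw [Fin.lt_def]
      omega
    have h1 : ¬ R (σ k) (σ l) := fun e => absurd (hτ _ _ e) (not_le.2 hkl)
    have h2 : ¬ R (σ l) (σ k) := fun e => by
      have := hσ _ _ e
      rw [Equiv.symm_apply_apply, Equiv.symm_apply_apply] at this
      order
    have hσ' : IsLinearExtension R (σ * Equiv.swap k l) := by
      intro x y hxy
      rw [mul_swap_symm_apply, mul_swap_symm_apply]
      rcases eq_or_ne x y with rfl | hne
      · exact le_rfl
      refine (swap_lt_swap hl (hσ.lt hxy hne) ?_).le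
      rintro ⟨hx, hy⟩
      obtain rfl := (Equiv.symm_apply_eq σ).1 hx
      obtain rfl := (Equiv.symm_apply_eq σ).1 hy
      exact h1 hxy
    have hmk : Quot.mk (CambrianMove δ) σ = Quot.mk (CambrianMove δ) (σ * Equiv.swap k l) :=
      (h.cambrianMove_or hσ hl h1 h2).elim Quot.sound fun e => (Quot.sound e).symm
    rw [hmk]
    refine ih _ ?_ hσ' rfl
    rw [← hm]
    refine Set.ncard_lt_ncard ⟨?_, fun hsub => ?_⟩
    · rintro ⟨x, y⟩ ⟨hx, hy⟩
      refine ⟨?_, hy⟩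
      simp only [mul_swap_symm_apply] at hx ⊢
      by_cases hc : Equiv.swap k l (σ.symm x) = k ∧ Equiv.swap k l (σ.symm y) = l
      · rw [Equiv.swap_apply_eq_iff, Equiv.swap_apply_eq_iff, Equiv.swap_apply_left,
          Equiv.swap_apply_right, Equiv.symm_apply_eq, Equiv.symm_apply_eq] at hc
        simp only [hc.1, hc.2] at hy
        order
      · have := swap_lt_swap hl hx hc
        rwa [Equiv.swap_apply_self, Equiv.swap_apply_self] at this
    · have hmem : (σ k, σ l) ∈ {p : Fin n × Fin n |
          σ.symm p.1 < σ.symm p.2 ∧ τ.symm p.2 < τ.symm p.1} := by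
        refine ⟨?_, hkl⟩
        simpa only [Equiv.symm_apply_apply] using hlt
      have := (hsub hmem).1
      simp only [mul_swap_symm_apply, Equiv.symm_apply_apply, Equiv.swap_apply_left,
        Equiv.swap_apply_right] at this
      order

/-! ### Minimal linear extensions and the order on classes. -/

theorem exists_perm_of_strictTotalOrder (lt : Fin n → Fin n → Prop) (irrefl : ∀ x, ¬ lt x x)
    (trans : ∀ x y z, lt x y → lt y z → lt x z) (total : ∀ x y, x ≠ y → lt x y ∨ lt y x) :
    ∃ σ : Equiv.Perm (Fin n), ∀ x y, lt x y ↔ σ.symm x < σ.symm y := by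
  have hcard (x : Fin n) : {y | lt y x}.ncard < n := by
    have : {y | lt y x}.ncard < (Set.univ : Set (Fin n)).ncard :=
      Set.ncard_lt_ncard ⟨Set.subset_univ _, fun h => irrefl x (h (Set.mem_univ x))⟩
    rwa [Set.ncard_univ, Nat.card_eq_fintype_card, Fintype.card_fin] at this
  let rank (x : Fin n) : Fin n := ⟨_, hcard x⟩
  have hlt {x y : Fin n} (h : lt x y) : rank x < rank y :=
    Set.ncard_lt_ncard ⟨fun z hz => trans _ _ _ hz h, fun hs => irrefl x (hs h)⟩
  have hinj : Function.Injective rank := by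
    intro x y hxy
    by_contra hne
    rcases total x y hne with h | h
    · exact (hlt h).ne hxy
    · exact (hlt h).ne' hxy
  refine ⟨(Equiv.ofBijective rank (Finite.injective_iff_bijective.1 hinj)).symm, fun x y => ?_⟩
  rw [Equiv.symm_symm, Equiv.ofBijective_apply, Equiv.ofBijective_apply]
  refine ⟨hlt, fun h => ?_⟩
  rcases eq_or_ne x y with rfl | hne
  · exact absurd h (lt_irrefl _)
  · exact (total x y hne).resolve_right fun k => absurd (hlt k) h.asymm

/-- The minimal linear extension of a permutree element poset. -/
theorem IsPEP.exists_min_linearExtension (hδ : δ.IsCovering) (h : IsPEP δ R) :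
    ∃ σ, IsLinearExtension R σ ∧ ∀ a b, a < b → (σ.symm b < σ.symm a ↔ R b a) := by
  have hbtw {u v w : Fin n} (hb : Btw u v w) (k : R u w) : R u v ∨ R v w :=
    (hδ.of_btw hb).imp (fun hp => h.pos hp hb k) fun hn => h.neg hn hb k
  -- Labels are kept in increasing order unless `R` forces a decreasing pair. Transitivity of this
  -- order rests on `hbtw`, hence on the covering hypothesis.
  obtain ⟨σ, hσ⟩ := exists_perm_of_strictTotalOrder
    (fun x y => (y < x ∧ R x y) ∨ (x < y ∧ ¬ R y x)) (by grind) (by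
      intro x y z hxy hyz
      have h1 := @hbtw x y z
      have h2 := @hbtw z y x
      have h3 := @hbtw y x z
      have h4 := @hbtw z x y
      have h5 := @hbtw x z y
      have h6 := @hbtw y z x
      have h7 := @IsPEP.trans n δ R h x y z
      have h8 := @IsPEP.trans n δ R h y z x
      have h9 := @IsPEP.trans n δ R h z x y
      simp only [Btw] at h1 h2 h3 h4 h5 h6
      grind) (by grind)
  refine ⟨σ, fun x y hxy => ?_, fun a b hab => ?_⟩
  · rcases lt_trichotomy x y with k | rfl | k
    · exact ((hσ x y).1 (.inr ⟨k, fun l => k.ne (h.antisymm hxy l)⟩)).le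
    · exact le_rfl
    · exact ((hσ x y).1 (.inl ⟨k, hxy⟩)).le
  · rw [← hσ]
    grind

/-- An increasing pair of `linRel` tests only non-inversions, a decreasing one only inversions. -/
theorem linRel_le_linRel (h : permWeakLE σ τ) : linRel δ σ ≤ linRel δ τ := by
  constructor
  · rintro a c ⟨hac, k⟩
    refine ⟨hac, fun b b' hbb hb hb' => ?_⟩
    have hlt : b < b' := by grind
    have := k b b' hbb hb hb'
    by_contra hcon
    have hne : σ.symm b ≠ σ.symm b' := fun e => hlt.ne (σ.symm.injective e)
    exact absurd (h b b' hlt (lt_of_le_of_ne (not_lt.1 hcon) hne.symm)) this.asymm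
  · rintro c a ⟨hac, k⟩
    exact ⟨hac, fun b b' hbb hb hb' => h b' b (by grind) (k b b' hbb hb hb')⟩

/-- The Cambrian lattices are sublattices of the lattice of integer posets. -/
theorem exists_isLatticeEmbedding_cambrian (hδ : δ.IsCovering) :
    ∃ f : CambrianClass δ → IRel n,
      IsLatticeEmbedding (cambrianLE δ) f ∧ Set.range f = PEP δ := by
  let f : CambrianClass δ → IRel n :=
    Quot.lift (linRel δ) fun _ _ => linRel_eq_of_cambrianMove hδ
  have hrange : Set.range f = PEP δ := by
    ext R
    rw [mem_PEP_iff hδ]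
    constructor
    · rintro ⟨⟨σ⟩, rfl⟩
      exact isPEP_linRel hδ
    · intro h
      obtain ⟨σ, hσ, -⟩ := h.exists_min_linearExtension hδ
      exact ⟨Quot.mk _ σ, (h.eq_linRel hσ).symm⟩
  refine ⟨f, isLatticeEmbedding_of_range hδ ?_ ?_ hrange, hrange⟩
  · rintro ⟨σ⟩ ⟨τ⟩ (h : linRel δ σ = linRel δ τ)
    exact (isPEP_linRel hδ).mk_eq_mk isLinearExtension_linRel (h ▸ isLinearExtension_linRel)
  · rintro x y
    constructor
    · rintro ⟨σ, τ, rfl, rfl, h⟩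
      exact linRel_le_linRel h
    · intro h
      induction x using Quot.ind with | _ σ
      induction y using Quot.ind with | _ τ
      have hle : linRel δ σ ≤ linRel δ τ := h
      -- The minimal representatives have the decreasing pairs as inversions, so inclusion of
      -- decreasing parts is the weak order between them.
      obtain ⟨σ', hσ', hs⟩ := (isPEP_linRel (σ := σ) hδ).exists_min_linearExtension hδ
      obtain ⟨τ', hτ', ht⟩ := (isPEP_linRel (σ := τ) hδ).exists_min_linearExtension hδ
      refine ⟨σ', τ', (isPEP_linRel hδ).mk_eq_mk hσ' isLinearExtension_linRel,
        (isPEP_linRel hδ).mk_eq_mk hτ' isLinearExtension_linRel, fun a b hab => ?_⟩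
      rw [hs a b hab, ht a b hab]
      exact fun k => (hle.2 b a ⟨hab.le, k⟩).2

end

theorem isCovering_of_isCompl {δ : PermutreeOrientation n} (h : IsCompl δ.pos δ.neg) :
    δ.IsCovering := fun i _ _ => by
  have : δ.pos ∪ δ.neg = Set.univ := h.sup_eq_top
  exact this ▸ Set.mem_univ i

/-! ### The boolean lattice -/

/-- The poset attached to a subset of an `(n - 1)`-element set. -/
def booleanRel (s : Set (Fin (n - 1))) : IRel n := fun a c =>
  ∀ i : Fin (n - 1), (a.val ≤ i.val ∧ i.val < c.val → i ∉ s) ∧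
    (c.val ≤ i.val ∧ i.val < a.val → i ∈ s)

theorem booleanRel_le_iff {s t : Set (Fin (n - 1))} : booleanRel s ≤ booleanRel t ↔ s ⊆ t := by
  constructor
  · intro h i hi
    have h1 : i.val < n := by omega
    have h2 : i.val + 1 < n := by omega
    -- Membership of `i` is read off from the decreasing pair of the consecutive labels `i + 1` and
    -- `i`.
    have := (h.2 ⟨i.val + 1, h2⟩ ⟨i.val, h1⟩ ⟨by simp, fun j => ⟨by simp; omega, ?_⟩⟩).2 i
    · exact this.2 ⟨le_rfl, Nat.lt_succ_self _⟩
    · rintro ⟨h3, h4⟩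
      have : j = i := Fin.ext (by simp at h3 h4; omega)
      exact this ▸ hi
  · intro h
    refine ⟨fun a c ⟨hac, k⟩ => ⟨hac, fun i => ⟨fun hi hs => (k i).1 hi (h hs), fun hi => ?_⟩⟩,
      fun c a ⟨hac, k⟩ => ⟨hac, fun i => ⟨fun hi => ?_, fun hi => h ((k i).2 hi)⟩⟩⟩ <;>
    · rw [Fin.le_def] at hac
      omega

theorem isCovering_univ : (⟨Set.univ, Set.univ⟩ : PermutreeOrientation n).IsCovering :=
  fun _ _ _ => .inl trivial

theorem isPEP_booleanRel (s : Set (Fin (n - 1))) :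
    IsPEP ⟨Set.univ, Set.univ⟩ (booleanRel s) := by
  have hstep {a c : Fin n} (hac : a.val < c.val) : ∃ b : Fin n, a.val < b.val ∧ b.val ≤ c.val ∧
      (booleanRel s a b ∨ booleanRel s b a) := by
    have h1 : a.val < n - 1 := by omega
    refine ⟨⟨a.val + 1, by omega⟩, by simp, by simp; omega, ?_⟩
    by_cases hs : (⟨a.val, h1⟩ : Fin (n - 1)) ∈ s
    · refine .inr fun i => ⟨fun hi => by simp at hi; omega, fun hi => ?_⟩
      have : i = ⟨a.val, h1⟩ := Fin.ext (by simp at hi ⊢; omega)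
      exact this ▸ hs
    · refine .inl fun i => ⟨fun hi => ?_, fun hi => by simp at hi; omega⟩
      have : i = ⟨a.val, h1⟩ := Fin.ext (by simp at hi ⊢; omega)
      exact this ▸ hs
  refine .of_link_lt ⟨fun u i => by omega, fun u v w huv hvw i => ?_, fun u v huv hvu => ?_⟩
    ?_ ?_ ?_
  · have h1 := huv i
    have h2 := hvw i
    constructor
    · intro hi
      by_cases hv : v.val ≤ i.val
      · exact h2.1 ⟨hv, hi.2⟩
      · exact h1.1 ⟨hi.1, by omega⟩
    · intro hi
      by_cases hv : v.val ≤ i.val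
      · exact h1.2 ⟨hv, hi.2⟩
      · exact h2.2 ⟨hi.1, by omega⟩
  · by_contra hne
    rcases lt_or_gt_of_ne (Fin.val_ne_of_ne hne) with h | h
    · have h1 : u.val < n - 1 := by omega
      exact (huv ⟨u.val, h1⟩).1 ⟨le_rfl, h⟩ ((hvu ⟨u.val, h1⟩).2 ⟨le_rfl, h⟩)
    · have h1 : v.val < n - 1 := by omega
      exact (hvu ⟨v.val, h1⟩).1 ⟨le_rfl, h⟩ ((huv ⟨v.val, h1⟩).2 ⟨le_rfl, h⟩)
  · intro a b c _ habc h i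
    simp only [Btw, Fin.lt_def] at habc
    exact ⟨fun hi => (h i).1 (by omega), fun hi => (h i).2 (by omega)⟩
  · intro a b c _ habc h i
    simp only [Btw, Fin.lt_def] at habc
    exact ⟨fun hi => (h i).1 (by omega), fun hi => (h i).2 (by omega)⟩
  · intro a c hac
    obtain ⟨b, hab, hbc, h⟩ := hstep hac
    rcases hbc.lt_or_eq with k | k
    · exact .inr (.inr ⟨b, hab, k, h.imp (fun h => ⟨trivial, h⟩) fun h => ⟨trivial, h⟩⟩)
    · obtain rfl := Fin.ext k
      exact h.imp id .inl

/-- With both conditions available at every label, a relation restricts to all consecutive labels in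
between, and consecutive labels are comparable because nothing separates them. -/
theorem IsPEP.eq_booleanRel {R : IRel n} (h : IsPEP ⟨Set.univ, Set.univ⟩ R) :
    R = booleanRel {i | R ⟨i.val + 1, by omega⟩ ⟨i.val, by omega⟩} := by
  have hsucc (i : ℕ) (hi : i + 1 < n) :
      R ⟨i, by omega⟩ ⟨i + 1, hi⟩ ∨ R ⟨i + 1, hi⟩ ⟨i, by omega⟩ := by
    rcases h.link (a := ⟨i, by omega⟩) (c := ⟨i + 1, hi⟩) (by simp) with k | k | ⟨b, hb, -⟩
    · exact .inl k
    · exact .inr k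
    · simp only [Btw, Fin.lt_def] at hb
      omega
  have hconv {a b c d : Fin n} (hac : R a c)
      (hb : a.val ≤ b.val ∧ b.val ≤ c.val ∨ c.val ≤ b.val ∧ b.val ≤ a.val)
      (hd : b.val ≤ d.val ∧ d.val ≤ c.val ∨ c.val ≤ d.val ∧ d.val ≤ b.val) : R b d := by
    have hbc : R b c := by
      by_cases hB : Btw a b c
      · exact h.neg trivial hB hac
      · simp only [Btw, Fin.lt_def] at hB
        have : b = a ∨ b = c := by simp only [Fin.ext_iff]; omega
        rcases this with rfl | rfl
        · exact hac
        · exact h.refl _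
    by_cases hB : Btw b d c
    · exact h.pos trivial hB hbc
    · simp only [Btw, Fin.lt_def] at hB
      have : d = b ∨ d = c := by simp only [Fin.ext_iff]; omega
      rcases this with rfl | rfl
      · exact h.refl _
      · exact hbc
  have hinc (m : ℕ) : ∀ a c : Fin n, a.val + m = c.val →
      (∀ i : Fin (n - 1), a.val ≤ i.val ∧ i.val < c.val →
        ¬ R ⟨i.val + 1, by omega⟩ ⟨i.val, by omega⟩) → R a c := by
    induction m with
    | zero => exact fun a c hac _ => (Fin.ext hac : a = c) ▸ h.refl a
    | succ m ih =>
      intro a c hac hi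
      have h1 : a.val + m + 1 < n := by omega
      have hc : c = ⟨a.val + m + 1, h1⟩ := Fin.ext hac.symm
      subst hc
      refine h.trans (ih a ⟨a.val + m, by omega⟩ rfl fun i hi' => hi i ?_)
        ((hsucc _ h1).resolve_right (hi ⟨a.val + m, by omega⟩ ?_))
      · simp at hi' ⊢; omega
      · simp
  have hdec (m : ℕ) : ∀ a c : Fin n, a.val + m = c.val →
      (∀ i : Fin (n - 1), a.val ≤ i.val ∧ i.val < c.val →
        R ⟨i.val + 1, by omega⟩ ⟨i.val, by omega⟩) → R c a := by
    induction m with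
    | zero => exact fun a c hac _ => (Fin.ext hac : a = c) ▸ h.refl a
    | succ m ih =>
      intro a c hac hi
      have h1 : a.val + m + 1 < n := by omega
      have hc : c = ⟨a.val + m + 1, h1⟩ := Fin.ext hac.symm
      subst hc
      refine h.trans (hi ⟨a.val + m, by omega⟩ ?_)
        (ih a ⟨a.val + m, by omega⟩ rfl fun i hi' => hi i ?_)
      · simp
      · simp at hi' ⊢; omega
  funext a c
  refine propext ⟨fun hac i => ⟨fun hi hR => ?_, fun hi => ?_⟩, fun k => ?_⟩
  · have h2 : R ⟨i.val, by omega⟩ ⟨i.val + 1, by omega⟩ :=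
      hconv hac (.inl ⟨hi.1, hi.2.le⟩) (.inl ⟨Nat.le_succ _, hi.2⟩)
    have := h.antisymm h2 hR
    simp at this
  · exact hconv hac (.inr ⟨by simp; omega, by simp; omega⟩) (.inr ⟨hi.1, Nat.le_succ _⟩)
  · rcases le_total a.val c.val with hac | hac
    · exact hinc (c.val - a.val) a c (by omega) fun i hi => (k i).1 hi
    · exact hdec (a.val - c.val) c a (by omega) fun i hi => (k i).2 hi

/-- The boolean lattice is a sublattice of the lattice of integer posets. -/
theorem exists_isLatticeEmbedding_boolean (n : ℕ) : ∃ f : Set (Fin (n - 1)) → IRel n,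
    IsLatticeEmbedding (fun s t => s ⊆ t) f ∧ Set.range f = PEP ⟨Set.univ, Set.univ⟩ := by
  have hrange : Set.range booleanRel = PEP (⟨Set.univ, Set.univ⟩ : PermutreeOrientation n) := by
    ext R
    rw [mem_PEP_iff isCovering_univ]
    constructor
    · rintro ⟨s, rfl⟩
      exact isPEP_booleanRel s
    · exact fun h => ⟨_, h.eq_booleanRel.symm⟩
  refine ⟨booleanRel, isLatticeEmbedding_of_range isCovering_univ ?_
    (fun _ _ => booleanRel_le_iff.symm) hrange, hrange⟩
  exact fun s t h => (booleanRel_le_iff.1 h.le).antisymm (booleanRel_le_iff.1 h.ge)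

/-! ### The descendant relation of a planar binary tree -/

/-- `desc t i j` holds if, in the inorder labelling of `t` starting at `0`, the node `i` is a
descendant of the node `j`. -/
def desc : BinaryTree Unit → ℕ → ℕ → Prop
  | .nil, _, _ => False
  | .node _ l r, i, j =>
    (i < l.numNodes ∧ j < l.numNodes ∧ desc l i j) ∨
    (j = l.numNodes ∧ i ≤ l.numNodes + r.numNodes) ∨
    (l.numNodes < i ∧ l.numNodes < j ∧ desc r (i - (l.numNodes + 1)) (j - (l.numNodes + 1)))

section
variable {l r : BinaryTree Unit} {i j : ℕ}

theorem desc_node_left (hi : i < l.numNodes) (hj : j < l.numNodes) :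
    desc (.node () l r) i j ↔ desc l i j := by
  simp only [desc]
  grind

theorem desc_node_right (hi : l.numNodes < i) (hj : l.numNodes < j) :
    desc (.node () l r) i j ↔ desc r (i - (l.numNodes + 1)) (j - (l.numNodes + 1)) := by
  simp only [desc]
  grind

theorem desc_node_root : desc (.node () l r) i l.numNodes ↔ i ≤ l.numNodes + r.numNodes := by
  simp only [desc]
  grind

theorem not_desc_of_le_of_lt (hi : l.numNodes ≤ i) (hj : j < l.numNodes) :
    ¬ desc (.node () l r) i j := by
  simp only [desc]
  grind

theorem not_desc_of_lt_of_le (hi : i ≤ l.numNodes) (hj : l.numNodes < j) :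
    ¬ desc (.node () l r) i j := by
  simp only [desc]
  grind

theorem desc_lt {t : BinaryTree Unit} : ∀ {i j : ℕ}, desc t i j →
    i < t.numNodes ∧ j < t.numNodes := by
  induction t with
  | nil => exact fun h => h.elim
  | node _ l r ihl ihr =>
    intro i j h
    simp only [BinaryTree.numNodes]
    rcases h with h | h | ⟨h1, h2, h⟩
    · omega
    · omega
    · have := ihr h
      omega

theorem desc_injective {s t : BinaryTree Unit} (h : ∀ i j, desc s i j ↔ desc t i j) : s = t := by
  induction s generalizing t with
  | nil =>
    cases t with
    | nil => rfl
    | node _ l r => exact ((h _ _).2 (desc_node_root.2 (Nat.le_add_right _ _))).elim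
  | node _ l r ihl ihr =>
    cases t with
    | nil => exact ((h _ _).1 (desc_node_root.2 (Nat.le_add_right _ _))).elim
    | node _ l' r' =>
      -- The root is above all nodes and below no other one, so its inorder label, the size of the
      -- left subtree, is determined.
      have hm : l.numNodes = l'.numNodes := by
        rcases lt_trichotomy l.numNodes l'.numNodes with k | k | k
        · refine absurd ((h _ _).1 (desc_node_root.2 ?_)) (not_desc_of_le_of_lt le_rfl k)
          exact (desc_lt ((h _ _).2 (desc_node_root.2 (Nat.le_add_right _ _)))).1 |> Nat.le_of_lt_succ
        · exact k
        · refine absurd ((h _ _).2 (desc_node_root.2 ?_)) (not_desc_of_le_of_lt le_rfl k)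
          exact (desc_lt ((h _ _).1 (desc_node_root.2 (Nat.le_add_right _ _)))).1 |> Nat.le_of_lt_succ
      have hl : l = l' := ihl fun i j => by
        by_cases hij : i < l.numNodes ∧ j < l.numNodes
        · rw [← desc_node_left (r := r) hij.1 hij.2, h,
            desc_node_left (hm ▸ hij.1) (hm ▸ hij.2)]
        · exact ⟨fun k => absurd (desc_lt k) hij, fun k => absurd (desc_lt k) (hm ▸ hij)⟩
      have hr : r = r' := ihr fun i j => by
        have := h (i + (l.numNodes + 1)) (j + (l.numNodes + 1))
        rw [desc_node_right (by omega) (by omega), desc_node_right (by omega) (by omega)] at this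
        simpa [hm] using this
      rw [hl, hr]

end

/-! ### The relations of binary trees -/

/-- The relations on the interval `[lo, hi)` which come from binary trees. -/
structure IsTreeRel (R : ℕ → ℕ → Prop) (lo hi : ℕ) : Prop where
  refl {i : ℕ} : lo ≤ i → i < hi → R i i
  trans {i j k : ℕ} : lo ≤ i → i < hi → lo ≤ j → j < hi → lo ≤ k → k < hi →
    R i j → R j k → R i k
  antisymm {i j : ℕ} : lo ≤ i → i < hi → lo ≤ j → j < hi → R i j → R j i → i = j
  conv {i j k : ℕ} : lo ≤ i → i < hi → lo ≤ k → k < hi → (i < j ∧ j < k ∨ k < j ∧ j < i) →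
    R i k → R j k
  link {i k : ℕ} : lo ≤ i → i < hi → lo ≤ k → k < hi → i ≠ k →
    R i k ∨ R k i ∨ ∃ j, (i < j ∧ j < k ∨ k < j ∧ j < i) ∧ R i j

theorem IsTreeRel.mono {R : ℕ → ℕ → Prop} {lo hi lo' hi' : ℕ} (h : IsTreeRel R lo hi)
    (hlo : lo ≤ lo') (hhi : hi' ≤ hi) : IsTreeRel R lo' hi' where
  refl h1 h2 := h.refl (by omega) (by omega)
  trans h1 h2 h3 h4 h5 h6 := h.trans (by omega) (by omega) (by omega) (by omega) (by omega)
    (by omega)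
  antisymm h1 h2 h3 h4 := h.antisymm (by omega) (by omega) (by omega) (by omega)
  conv h1 h2 h3 h4 := h.conv (by omega) (by omega) (by omega) (by omega)
  link h1 h2 h3 h4 := h.link (by omega) (by omega) (by omega) (by omega)

/-- A label with the most descendants is maximal, and a separating label towards an unrelated one
would lie above it. -/
theorem IsTreeRel.exists_top {R : ℕ → ℕ → Prop} {lo hi : ℕ} (h : IsTreeRel R lo hi)
    (hlt : lo < hi) : ∃ m, lo ≤ m ∧ m < hi ∧ ∀ i, lo ≤ i → i < hi → R i m := by
  obtain ⟨m, ⟨hm, hm'⟩, hmax⟩ := Set.exists_max_image (Set.Ico lo hi)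
    (fun m => {i | i ∈ Set.Ico lo hi ∧ R i m}.ncard) (Set.finite_Ico lo hi) ⟨lo, le_rfl, hlt⟩
  have htop (c : ℕ) (h1 : lo ≤ c) (h2 : c < hi) (hmc : R m c) : c = m := by
    by_contra hne
    refine absurd (hmax c ⟨h1, h2⟩) (not_le.2 (Set.ncard_lt_ncard ⟨?_, fun hs => ?_⟩
      ((Set.finite_Ico lo hi).subset fun i hi => hi.1)))
    · exact fun i hi => ⟨hi.1, h.trans hi.1.1 hi.1.2 hm hm' h1 h2 hi.2 hmc⟩
    · have hc : c ∈ {i | i ∈ Set.Ico lo hi ∧ R i m} := hs ⟨⟨h1, h2⟩, h.refl h1 h2⟩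
      exact hne (h.antisymm h1 h2 hm hm' hc.2 hmc)
  refine ⟨m, hm, hm', fun i h1 h2 => ?_⟩
  by_cases hne : m = i
  · exact hne ▸ h.refl hm hm'
  rcases h.link hm hm' h1 h2 hne with k | k | ⟨j, hj, k⟩
  · exact absurd (htop i h1 h2 k).symm hne
  · exact k
  · have := htop j (by omega) (by omega) k
    omega

/-- The top label becomes the root. A relation passing over it, or starting at it, would put the
root below another label, so the relation splits into the two intervals beside it. -/
theorem IsTreeRel.exists_tree {R : ℕ → ℕ → Prop} (N : ℕ) : ∀ lo : ℕ, IsTreeRel R lo (lo + N) →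
    ∃ t : BinaryTree Unit, t.numNodes = N ∧
      ∀ i j, i < N → j < N → (desc t i j ↔ R (lo + i) (lo + j)) := by
  induction N using Nat.strong_induction_on with
  | _ N ih =>
    intro lo h
    rcases Nat.eq_zero_or_pos N with rfl | hN
    · exact ⟨.nil, rfl, fun i j hi => absurd hi (Nat.not_lt_zero i)⟩
    obtain ⟨m, hm, hm', htop⟩ := h.exists_top (by omega)
    obtain ⟨a, rfl⟩ := Nat.exists_eq_add_of_le hm
    obtain ⟨l, hl, hl'⟩ := ih a (by omega) lo (h.mono le_rfl (by omega))
    obtain ⟨r, hr, hr'⟩ := ih (N - (a + 1)) (by omega) (lo + (a + 1))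
      (h.mono (by omega) (by omega))
    refine ⟨.node () l r, by simp only [BinaryTree.numNodes]; omega, fun i j hi hj => ?_⟩
    have hanti (c : ℕ) (hc : c < N) (k : R (lo + a) (lo + c)) : a = c := by
      have := h.antisymm hm hm' (by omega) (by omega) k (htop _ (by omega) (by omega))
      omega
    have hside (hij : i < a ∧ a < j ∨ j < a ∧ a < i) : ¬ R (lo + i) (lo + j) := fun k => by
      have := hanti j hj (h.conv (by omega) (by omega) (by omega) (by omega) (by omega) k)
      omega
    subst hl
    rcases lt_trichotomy j l.numNodes with hj' | rfl | hj'
    · rcases lt_trichotomy i l.numNodes with hi' | rfl | hi'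
      · rw [desc_node_left hi' hj', hl' i j hi' hj']
      · exact iff_of_false (not_desc_of_le_of_lt le_rfl hj') fun k => hj'.ne' (hanti j hj k)
      · exact iff_of_false (not_desc_of_le_of_lt hi'.le hj') (hside (.inr ⟨hj', hi'⟩))
    · exact iff_of_true (desc_node_root.2 (by omega)) (htop _ (by omega) (by omega))
    · rcases lt_trichotomy i l.numNodes with hi' | rfl | hi'
      · exact iff_of_false (not_desc_of_lt_of_le hi'.le hj') (hside (.inl ⟨hi', hj'⟩))
      · exact iff_of_false (not_desc_of_lt_of_le le_rfl hj') fun k => hj'.ne (hanti j hj k)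
      · rw [desc_node_right hi' hj', hr' _ _ (by omega) (by omega)]
        have h1 : lo + (l.numNodes + 1) + (i - (l.numNodes + 1)) = lo + i := by omega
        have h2 : lo + (l.numNodes + 1) + (j - (l.numNodes + 1)) = lo + j := by omega
        rw [h1, h2]

/-! ### Descendant relations satisfy the axioms of tree relations. -/

theorem desc_refl {t : BinaryTree Unit} : ∀ {i : ℕ}, i < t.numNodes → desc t i i := by
  induction t with
  | nil => exact fun h => absurd h (Nat.not_lt_zero _)
  | node _ l r ihl ihr =>
    intro i hi
    simp only [BinaryTree.numNodes] at hi
    rcases lt_trichotomy i l.numNodes with h | rfl | h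
    · exact (desc_node_left h h).2 (ihl h)
    · exact desc_node_root.2 (by omega)
    · exact (desc_node_right h h).2 (ihr (by omega))

theorem desc_antisymm {t : BinaryTree Unit} : ∀ {i j : ℕ}, desc t i j → desc t j i → i = j := by
  induction t with
  | nil => exact fun h => h.elim
  | node _ l r ihl ihr =>
    intro i j h k
    simp only [desc] at h k
    rcases h with h | h | h <;> rcases k with k | k | k <;> try omega
    · exact ihl h.2.2 k.2.2
    · have := ihr h.2.2 k.2.2
      omega

theorem desc_trans {t : BinaryTree Unit} : ∀ {i j k : ℕ}, desc t i j → desc t j k →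
    desc t i k := by
  induction t with
  | nil => exact fun h => h.elim
  | node _ l r ihl ihr =>
    intro i j k h1 h2
    have hi := (desc_lt h1).1
    simp only [BinaryTree.numNodes] at hi
    simp only [desc] at h1 h2 ⊢
    rcases h1 with h1 | h1 | h1 <;> rcases h2 with h2 | h2 | h2 <;> try omega
    · exact .inl ⟨h1.1, h2.2.1, ihl h1.2.2 h2.2.2⟩
    · exact .inr (.inr ⟨h1.1, h2.2.1, ihr h1.2.2 h2.2.2⟩)

theorem desc_conv {t : BinaryTree Unit} : ∀ {i j k : ℕ}, (i < j ∧ j < k ∨ k < j ∧ j < i) →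
    desc t i k → desc t j k := by
  induction t with
  | nil => exact fun _ h => h.elim
  | node _ l r ihl ihr =>
    intro i j k hj h
    simp only [desc] at h ⊢
    rcases h with h | h | h
    · exact .inl ⟨by omega, h.2.1, ihl hj h.2.2⟩
    · exact .inr (.inl ⟨h.1, by omega⟩)
    · exact .inr (.inr ⟨by omega, h.2.1, ihr (by omega) h.2.2⟩)

theorem desc_link {t : BinaryTree Unit} : ∀ {i k : ℕ}, i < t.numNodes → k < t.numNodes →
    i ≠ k → desc t i k ∨ desc t k i ∨ ∃ j, (i < j ∧ j < k ∨ k < j ∧ j < i) ∧ desc t i j := by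
  induction t with
  | nil => exact fun h => absurd h (Nat.not_lt_zero _)
  | node _ l r ihl ihr =>
    intro i k hi hk hne
    simp only [BinaryTree.numNodes] at hi hk
    have hroot (c : ℕ) (hc : c < l.numNodes + r.numNodes + 1) :
        desc (.node () l r) c l.numNodes := desc_node_root.2 (by omega)
    rcases lt_trichotomy i l.numNodes with hi' | rfl | hi'
    · rcases lt_trichotomy k l.numNodes with hk' | rfl | hk'
      · rw [desc_node_left hi' hk', desc_node_left hk' hi']
        refine (ihl hi' hk' hne).imp id (Or.imp id ?_)
        rintro ⟨j, hj, h⟩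
        exact ⟨j, hj, (desc_node_left hi' (by omega)).2 h⟩
      · exact .inl (hroot i hi)
      · exact .inr (.inr ⟨_, .inl ⟨hi', hk'⟩, hroot i hi⟩)
    · exact .inr (.inl (hroot k hk))
    · rcases lt_trichotomy k l.numNodes with hk' | rfl | hk'
      · exact .inr (.inr ⟨_, .inr ⟨hk', hi'⟩, hroot i hi⟩)
      · exact .inl (hroot i hi)
      · rw [desc_node_right hi' hk', desc_node_right hk' hi']
        refine (ihr (by omega) (by omega) (by omega)).imp id (Or.imp id ?_)
        rintro ⟨j, hj, h⟩
        refine ⟨j + (l.numNodes + 1), by omega, (desc_node_right hi' (by omega)).2 ?_⟩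
        rwa [Nat.add_sub_cancel]

/-! ### Rotations -/

theorem RightRotation.numNodes_eq {s t : BinaryTree Unit} (h : RightRotation s t) :
    s.numNodes = t.numNodes := by
  induction h with
  | root => simp only [BinaryTree.numNodes]; omega
  | left _ _ _ _ ih => simp only [BinaryTree.numNodes, ih]
  | right _ _ _ _ ih => simp only [BinaryTree.numNodes, ih]

/-- Let `x < y` be the labels of the two rotated nodes. The rotation loses the relations from `A`
and `x` to `y`, which are increasing, and gains those from `y` and `C` to `x`, which are decreasing.
-/
theorem RightRotation.desc_inc {s t : BinaryTree Unit} (h : RightRotation s t) :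
    ∀ {i j : ℕ}, i ≤ j → desc t i j → desc s i j := by
  induction h with
  | root A B C =>
    intro i j hij k
    have hk := desc_lt k
    simp only [desc, BinaryTree.numNodes] at k hk ⊢
    rcases k with k | k | ⟨h1, h2, k | k | ⟨h3, h4, k⟩⟩
    · exact .inl ⟨by omega, by omega, .inl k⟩
    · exact .inl ⟨by omega, by omega, .inr (.inl ⟨by omega, by omega⟩)⟩
    · exact .inl ⟨by omega, by omega, .inr (.inr ⟨h1, h2, k.2.2⟩)⟩
    · exact .inr (.inl ⟨by omega, by omega⟩)
    · refine .inr (.inr ⟨by omega, by omega, ?_⟩)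
      convert k using 1 <;> omega
  | left l l' r h ih =>
    intro i j hij k
    simp only [desc, h.numNodes_eq] at k ⊢
    exact k.imp (fun k => ⟨k.1, k.2.1, ih hij k.2.2⟩) id
  | right l r r' h ih =>
    intro i j hij k
    simp only [desc, h.numNodes_eq] at k ⊢
    exact k.imp id (Or.imp id fun k => ⟨k.1, k.2.1, ih (by omega) k.2.2⟩)

theorem RightRotation.desc_dec {s t : BinaryTree Unit} (h : RightRotation s t) :
    ∀ {i j : ℕ}, j ≤ i → desc s i j → desc t i j := by
  induction h with
  | root A B C =>
    intro i j hij k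
    have hk := desc_lt k
    simp only [desc, BinaryTree.numNodes] at k hk ⊢
    rcases k with ⟨h1, h2, k | k | ⟨h3, h4, k⟩⟩ | k | ⟨h1, h2, k⟩
    · exact .inl k
    · exact .inr (.inl ⟨by omega, by omega⟩)
    · exact .inr (.inr ⟨h3, h4, .inl ⟨by omega, by omega, k⟩⟩)
    · exact .inr (.inr ⟨by omega, by omega, .inr (.inl ⟨by omega, by omega⟩)⟩)
    · refine .inr (.inr ⟨by omega, by omega, .inr (.inr ⟨by omega, by omega, ?_⟩)⟩)
      convert k using 1 <;> omega
  | left l l' r h ih =>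
    intro i j hij k
    simp only [desc, h.numNodes_eq] at k ⊢
    exact k.imp (fun k => ⟨k.1, k.2.1, ih hij k.2.2⟩) id
  | right l r r' h ih =>
    intro i j hij k
    simp only [desc, h.numNodes_eq] at k ⊢
    exact k.imp id (Or.imp id fun k => ⟨k.1, k.2.1, ih (by omega) k.2.2⟩)

theorem reflTransGen_left {l l' r : BinaryTree Unit}
    (h : Relation.ReflTransGen RightRotation l l') :
    Relation.ReflTransGen RightRotation (.node () l r) (.node () l' r) := by
  induction h with
  | refl => exact .refl
  | tail _ h ih => exact ih.tail (.left _ _ _ h)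

theorem reflTransGen_right {l r r' : BinaryTree Unit}
    (h : Relation.ReflTransGen RightRotation r r') :
    Relation.ReflTransGen RightRotation (.node () l r) (.node () l r') := by
  induction h with
  | refl => exact .refl
  | tail _ h ih => exact ih.tail (.right _ _ _ h)

/-- Right rotations bring to the root a node all of whose predecessors are its descendants. -/
theorem exists_rotation_root (s : BinaryTree Unit) : ∀ m, m < s.numNodes →
    (∀ i < m, desc s i m) → ∃ A B : BinaryTree Unit, A.numNodes = m ∧
      A.numNodes + B.numNodes + 1 = s.numNodes ∧
      Relation.ReflTransGen RightRotation s (.node () A B) ∧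
      (∀ i j, i < m → j < m → (desc A i j ↔ desc s i j)) ∧
      ∀ i j, m < i → m < j → (desc B (i - (m + 1)) (j - (m + 1)) ↔ desc s i j) := by
  induction s with
  | nil => exact fun m hm => absurd hm (Nat.not_lt_zero m)
  | node _ l r ihl ihr =>
    intro m hm hd
    rcases lt_trichotomy m l.numNodes with h | rfl | h
    · obtain ⟨A, B, hA, hAB, hrot, h1, h2⟩ :=
        ihl m h fun i hi => (desc_node_left (hi.trans h) h).1 (hd i hi)
      refine ⟨A, .node () B r, hA, ?_, ?_, fun i j hi hj => ?_, fun i j hi hj => ?_⟩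
      · simp only [BinaryTree.numNodes]
        omega
      -- Once `m` is the root of the left subtree, one rotation at the top lifts it.
      · exact (reflTransGen_left hrot).tail (.root A B r)
      · rw [h1 i j hi hj, desc_node_left (by omega) (by omega)]
      · simp only [desc]
        refine or_congr ?_ (or_congr (by omega) ?_)
        · constructor
          · rintro ⟨h3, h4, h5⟩
            exact ⟨by omega, by omega, (h2 i j hi hj).1 h5⟩
          · rintro ⟨h3, h4, h5⟩
            exact ⟨by omega, by omega, (h2 i j hi hj).2 h5⟩
        · have h3 (i : ℕ) : i - (m + 1) - (B.numNodes + 1) = i - (l.numNodes + 1) := by omega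
          rw [h3, h3]
          exact and_congr (by omega) (and_congr (by omega) Iff.rfl)
    · exact ⟨l, r, rfl, rfl, .refl, fun i j hi hj => (desc_node_left hi hj).symm,
        fun i j hi hj => (desc_node_right hi hj).symm⟩
    · exact absurd (hd _ h) (not_desc_of_lt_of_le le_rfl h)

/-- All labels smaller than the root of `t` are its descendants in `t`, hence also in `s`, so
rotations lift it to the root of `s`. The subtrees on both sides still satisfy the two inclusions,
and induction applies to them. -/
theorem reflTransGen_rightRotation (t : BinaryTree Unit) : ∀ s : BinaryTree Unit,
    s.numNodes = t.numNodes → (∀ i j, i ≤ j → desc t i j → desc s i j) →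
    (∀ i j, j ≤ i → desc s i j → desc t i j) → Relation.ReflTransGen RightRotation s t := by
  induction t with
  | nil =>
    intro s hs _ _
    cases s with
    | nil => exact .refl
    | node => exact absurd hs (Nat.succ_ne_zero _)
  | node _ l r ihl ihr =>
    intro s hs hinc hdec
    simp only [BinaryTree.numNodes] at hs
    obtain ⟨A, B, hA, hAB, hrot, h1, h2⟩ := exists_rotation_root s l.numNodes (by omega)
      fun i hi => hinc i _ hi.le (desc_node_root.2 (by omega))
    have hl : Relation.ReflTransGen RightRotation A l := by
      refine ihl A hA (fun i j hij h => ?_) fun i j hij h => ?_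
      · obtain ⟨h3, h4⟩ := desc_lt h
        exact (h1 i j h3 h4).2 (hinc i j hij ((desc_node_left h3 h4).2 h))
      · obtain ⟨h3, h4⟩ := desc_lt h
        rw [hA] at h3 h4
        exact (desc_node_left h3 h4).1 (hdec i j hij ((h1 i j h3 h4).1 h))
    have hr : Relation.ReflTransGen RightRotation B r := by
      have h3 (i : ℕ) : l.numNodes < i + (l.numNodes + 1) := by omega
      have h4 (i j : ℕ) := h2 _ _ (h3 i) (h3 j)
      have h5 (i j : ℕ) := desc_node_right (r := r) (h3 i) (h3 j)
      simp only [Nat.add_sub_cancel] at h4 h5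
      refine ihr B (by omega) (fun i j hij h => ?_) fun i j hij h => ?_
      · exact (h4 i j).2 (hinc _ _ (by omega) ((h5 i j).2 h))
      · exact (h5 i j).1 (hdec _ _ (by omega) ((h4 i j).1 h))
    exact hrot.trans ((reflTransGen_left hl).trans (reflTransGen_right hr))

/-! ### The Tamari lattice -/

/-- The poset of a planar binary tree. -/
def treeRel (t : TamariTree n) : IRel n := fun i j => desc t.1 i.val j.val

theorem isCovering_empty_univ : (⟨∅, Set.univ⟩ : PermutreeOrientation n).IsCovering :=
  fun _ _ _ => .inr trivial

theorem isPEP_treeRel (t : TamariTree n) : IsPEP ⟨∅, Set.univ⟩ (treeRel t) where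
  mem_IPos := ⟨fun u => desc_refl (t.2.symm ▸ u.2), fun _ _ _ => desc_trans,
    fun _ _ h k => Fin.ext (desc_antisymm h k)⟩
  neg _ hb h := desc_conv hb h
  pos hb := hb.elim
  link {a c} hac := by
    rcases desc_link (t := t.1) (by rw [t.2]; exact a.2) (by rw [t.2]; exact c.2)
      (Fin.val_ne_of_ne hac) with h | h | ⟨j, hj, h⟩
    · exact .inl h
    · exact .inr (.inl h)
    · exact .inr (.inr ⟨⟨j, by omega⟩, hj, .inl ⟨trivial, h⟩⟩)

theorem IsPEP.exists_treeRel {R : IRel n} (h : IsPEP ⟨∅, Set.univ⟩ R) :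
    ∃ t, treeRel t = R := by
  let S : ℕ → ℕ → Prop := fun i j => ∃ (hi : i < n) (hj : j < n), R ⟨i, hi⟩ ⟨j, hj⟩
  have hS : IsTreeRel S 0 (0 + n) := by
    rw [Nat.zero_add]
    refine ⟨fun _ hi => ⟨hi, hi, h.refl _⟩, ?_, ?_, ?_, ?_⟩
    · rintro i j k - - - - - - ⟨hi, hj, h1⟩ ⟨_, hk, h2⟩
      exact ⟨hi, hk, h.trans h1 h2⟩
    · rintro i j - - - - ⟨hi, hj, h1⟩ ⟨_, _, h2⟩
      exact Fin.val_eq_of_eq (h.antisymm h1 h2)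
    · rintro i j k - - - - hj ⟨hi, hk, h1⟩
      have hjn : j < n := by omega
      exact ⟨hjn, hk, h.neg (a := ⟨i, hi⟩) (b := ⟨j, hjn⟩) (c := ⟨k, hk⟩) trivial hj h1⟩
    · rintro i k - hi - hk hne
      rcases h.link (a := ⟨i, hi⟩) (c := ⟨k, hk⟩) (fun e => hne (Fin.val_eq_of_eq e)) with
        h | h | ⟨b, hb, h | h⟩
      · exact .inl ⟨_, _, h⟩
      · exact .inr (.inl ⟨_, _, h⟩)
      · exact .inr (.inr ⟨b.val, hb, _, b.2, h.2⟩)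
      · exact h.1.elim
  obtain ⟨t, ht, hd⟩ := IsTreeRel.exists_tree n 0 hS
  refine ⟨⟨t, ht⟩, ?_⟩
  funext i j
  apply propext
  have := hd i j i.2 j.2
  rw [Nat.zero_add, Nat.zero_add] at this
  exact this.trans ⟨fun ⟨_, _, h⟩ => h, fun h => ⟨i.2, j.2, h⟩⟩

theorem tamariLE_iff {s t : TamariTree n} : tamariLE s t ↔ treeRel s ≤ treeRel t := by
  constructor
  · intro h
    have key : (∀ i j, i ≤ j → desc t.1 i j → desc s.1 i j) ∧
        ∀ i j, j ≤ i → desc s.1 i j → desc t.1 i j := by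
      unfold tamariLE at h
      generalize s.1 = a at h
      generalize t.1 = b at h
      induction h with
      | refl => exact ⟨fun _ _ _ h => h, fun _ _ _ h => h⟩
      | tail _ h ih =>
        exact ⟨fun i j hij k => ih.1 i j hij (h.desc_inc hij k),
          fun i j hij k => h.desc_dec hij (ih.2 i j hij k)⟩
    exact ⟨fun a b h => ⟨h.1, key.1 _ _ h.1 h.2⟩, fun a b h => ⟨h.1, key.2 _ _ h.1 h.2⟩⟩
  · intro h
    refine reflTransGen_rightRotation t.1 s.1 (s.2.trans t.2.symm) (fun i j hij k => ?_)
      fun i j hij k => ?_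
    · obtain ⟨hi, hj⟩ := desc_lt k
      rw [t.2] at hi hj
      exact (h.1 ⟨i, hi⟩ ⟨j, hj⟩ ⟨hij, k⟩).2
    · obtain ⟨hi, hj⟩ := desc_lt k
      rw [s.2] at hi hj
      exact (h.2 ⟨i, hi⟩ ⟨j, hj⟩ ⟨hij, k⟩).2

theorem treeRel_injective : Function.Injective (treeRel (n := n)) := by
  intro s t h
  refine Subtype.ext (desc_injective fun i j => ⟨fun k => ?_, fun k => ?_⟩)
  · obtain ⟨hi, hj⟩ := desc_lt k
    rw [s.2] at hi hj
    exact (congrFun (congrFun h ⟨i, hi⟩) ⟨j, hj⟩).mp k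
  · obtain ⟨hi, hj⟩ := desc_lt k
    rw [t.2] at hi hj
    exact (congrFun (congrFun h ⟨i, hi⟩) ⟨j, hj⟩).mpr k

/-- The Tamari lattice is a sublattice of the lattice of integer posets. -/
theorem exists_isLatticeEmbedding_tamari (n : ℕ) : ∃ f : TamariTree n → IRel n,
    IsLatticeEmbedding tamariLE f ∧ Set.range f = PEP ⟨∅, Set.univ⟩ := by
  have hrange : Set.range treeRel = PEP (⟨∅, Set.univ⟩ : PermutreeOrientation n) := by
    ext R
    rw [mem_PEP_iff isCovering_empty_univ]
    constructor
    · rintro ⟨t, rfl⟩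
      exact isPEP_treeRel t
    · exact fun h => h.exists_treeRel
  exact ⟨treeRel, isLatticeEmbedding_of_range isCovering_empty_univ treeRel_injective
    (fun _ _ => tamariLE_iff) hrange, hrange⟩

end IntegerPosets

theorem mainTheorem5 (n : ℕ) :
    -- the weak order on integer posets is a lattice with meet `meetT` and join `joinT`
    IsLatticeUnderMeetTJoinT (IPos n) ∧
    -- covering orientations
    (∀ δ : PermutreeOrientation n, δ.IsCovering → InducesSublattice (PEP δ)) ∧
    -- the Tamari lattice, realized by the orientation `(n, ∅, [n])`
    (∃ f : TamariTree n → IRel n,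
      IsLatticeEmbedding tamariLE f ∧ Set.range f = PEP ⟨∅, Set.univ⟩) ∧
    -- the Cambrian lattices of type A, realized by the orientations with `δ⁺ ⊔ δ⁻ = [n]`
    (∀ δ : PermutreeOrientation n, IsCompl δ.pos δ.neg →
      ∃ f : CambrianClass δ → IRel n,
        IsLatticeEmbedding (cambrianLE δ) f ∧ Set.range f = PEP δ) ∧
    -- the boolean lattice of rank `n - 1`, realized by the orientation `(n, [n], [n])`
    (∃ f : Set (Fin (n - 1)) → IRel n,
      IsLatticeEmbedding (fun s t => s ⊆ t) f ∧ Set.range f = PEP ⟨Set.univ, Set.univ⟩) :=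
  ⟨isLatticeUnderMeetTJoinT_IPos, fun _ => inducesSublattice_PEP,
    exists_isLatticeEmbedding_tamari n,
    fun _ h => exists_isLatticeEmbedding_cambrian (isCovering_of_isCompl h),
    exists_isLatticeEmbedding_boolean n⟩
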